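/- **Notation.** For $x\in\mathbb R^3$, $r>0$ put $B_r(x)=\{y\in\mathbb R^3:|x-y|<r\}$, and for $z_0=(x_0,t_0)\in\mathbb R^3\times\mathbb R$ put $Q_r(z_0)=B_r(x_0)\times(t_0-r^2,t_0)$. **Suitable weak solutions.** Let $\Omega\subset\mathbb R^3$ be open and $-\infty<a<b<\infty$. A pair $(u,p)$, with $u$ taking values in $\mathbb R^3$ and $p$ in $\mathbb R$, is a *suitable weak solution* of the Navier–Stokes equations in $\Omega\times(a,b)$ if 1. $u\in L^\infty(a,b;L^2(\Omega))\cap L^2(a,b;W^{1,2}(\Omega))$ and $p\in L^{3/2}(\Omega\times(a,b))$; 2. for all $\psi\in C_0^\infty(\Omega\times(a,b);\mathbb R^3)$, $$\int_a^b\int_\Omega\{-u\cdot\psi_t+\nabla u:\nabla\psi-(u\otimes u):\nabla\psi-p\,\mathrm{div}\,\psi\}\,dx\,dt=0,$$ and, for a.e. $t\in(a,b)$ and all real-valued $\phi\in C_0^\infty(\Omega)$, $\int_\Omega u(x,t)\cdot\nabla\phi(x)\,dx=0$; 3. for a.e. $t\in(a,b)$ and every nonnegative $\phi\in C_0^\infty(\mathbb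 R^3\times\mathbb R)$ vanishing in a neighborhood of $\Omega\times\{a\}\cup\partial\Omega\times[a,b]$, $$\int_\Omega|u(x,t)|^2\phi(x,t)\,dx+2\int_a^t\int_\Omega|\nabla u|^2\phi\,dx\,ds\le\int_a^t\int_\Omega|u|^2(\phi_t+\Delta\phi)\,dx\,ds+\int_a^t\int_\Omega(|u|^2+2p)\,u\cdot\nabla\phi\,dx\,ds .$$ Here $\nabla u$ is the weak gradient in the space variables. **Scale-invariant quantities** (with values in $[0,\infty]$). For $z_0=(x_0,t_0)$ and $r>0$, $$A(z_0,r)=\sup_{t_0-r^2\le t\le t_0}r^{-1}\int_{B_r(x_0)}|u(x,t)|^2dx,\qquad B(z_0,r)=r^{-1}\int_{Q_r(z_0)}|\nabla u|^2dx\,dt,$$ $$C_{\alpha,\beta}(z_0,r)=r^{-\frac{3\beta}2}\int_{t_0-r^2}^{t_0}\|u(\cdot,t)\|_{L^{2\alpha}(B_r(x_0))}^{2\beta}dt,\qquad D_{\alpha,\beta}(z_0,r)=r^{-\frac{3\beta}2}\int_{t_0-r^2}^{t_0}\|p(\cdot,t)\|_{L^{\alpha}(B_r(x_0))}^{\beta}dt,$$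 where the supremum in $A$ is the essential supremum over $t$. **Proposition.** There is an absolute constant $C<\infty$ such that, for every $\alpha\in[6/5,2]$ and $\beta=\frac{4\alpha}{7\alpha-6}$, every $z_0\in\mathbb R^3\times\mathbb R$, every $r>0$ and every suitable weak solution $(u,p)$ of the Navier–Stokes equations in $Q_r(z_0)$, $$A(z_0,r/2)+B(z_0,r/2)\le C\Big[C_{\alpha,\beta}(z_0,r)^{\frac1\beta}+C_{\alpha,\beta}(z_0,r)^{\frac2\beta}+D_{\alpha,\beta}(z_0,r)^{\frac2\beta}\Big].$$ -/

import Mathlib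

open MeasureTheory Set Filter Topology
open scoped ENNReal NNReal ContDiff

noncomputable section

namespace NavierStokes

/-- Three-dimensional Euclidean space. -/
abbrev Space : Type := EuclideanSpace ℝ (Fin 3)

/-- Space-time; a point is `z = (x, t)`. -/
abbrev SpaceTime : Type := Space × ℝ

/-- The `j`-th standard unit vector. -/
def unitVec (j : Fin 3) : Space := EuclideanSpace.single j 1

section Derivatives

variable {F : Type*} [NormedAddCommGroup F] [NormedSpace ℝ F]

/-- Classical time derivative `∂_t f` (applied to smooth test functions only). -/
def timeDeriv (f : SpaceTime → F) (z : SpaceTime) : F :=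
  fderiv ℝ f z (0, 1)

/-- Classical spatial partial derivative `∂_j f` (applied to smooth test functions only). -/
def spaceDeriv (j : Fin 3) (f : SpaceTime → F) (z : SpaceTime) : F :=
  fderiv ℝ f z (unitVec j, 0)

/-- The Laplacian in the space variables, `Δ f = ∑ j, ∂_j ∂_j f`. -/
def spaceLaplacian (f : SpaceTime → F) (z : SpaceTime) : F :=
  ∑ j, spaceDeriv j (spaceDeriv j f) z

end Derivatives

/-- `f ∈ C_0^∞(U; F)`: `f` is smooth, with compact support contained in `U`. -/
def IsTestFunction {X F : Type*} [NormedAddCommGroup X] [NormedSpace ℝ X]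
    [NormedAddCommGroup F] [NormedSpace ℝ F] (U : Set X) (f : X → F) : Prop :=
  ContDiff ℝ ∞ f ∧ HasCompactSupport f ∧ tsupport f ⊆ U

/-- `G = (G_j)` is the weak gradient of the scalar function `f` on `Ω ⊆ ℝ³`:
`∫_Ω f ∂_j φ = - ∫_Ω G_j φ` for all `φ ∈ C_0^∞(Ω)`. -/
def IsWeakGradient (Ω : Set Space) (f : Space → ℝ) (G : Fin 3 → Space → ℝ) : Prop :=
  ∀ φ : Space → ℝ, IsTestFunction Ω φ → ∀ j,
    ∫ x in Ω, f x * fderiv ℝ φ x (unitVec j) = - ∫ x in Ω, G j x * φ x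

/-- The parabolic boundary `Ω × {t = a} ∪ ∂Ω × [a, b]` of `Ω × (a, b)`. -/
def parabolicBoundary (Ω : Set Space) (a b : ℝ) : Set SpaceTime :=
  (Ω ×ˢ {a}) ∪ (frontier Ω ×ˢ Icc a b)

/-- The squared (Frobenius) norm `|M|² = ∑ i j, M_ij²`. -/
def frobSq (M : Fin 3 → Fin 3 → ℝ) : ℝ := ∑ i, ∑ j, M i j ^ 2

/-- `(u, p)` is a suitable weak solution to the Navier-Stokes equations in `Ω × (a, b)`, and `Du` is
the weak spatial gradient of `u` there, with `Du z i j = ∂_j u_i (z)`.  The weak gradient is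
determined by `u` up to a null set of `Ω × (a, b)`.  Only the values on `Ω × (a, b)` of the three
functions matter. -/
structure IsSuitableWeakSolution (u : SpaceTime → Space) (Du : SpaceTime → Fin 3 → Fin 3 → ℝ)
    (p : SpaceTime → ℝ) (Ω : Set Space) (a b : ℝ) : Prop where
  isOpen_domain : IsOpen Ω
  lt : a < b
  /-- `u` is (jointly) measurable. -/
  measurable_u : AEStronglyMeasurable u (volume.restrict (Ω ×ˢ Ioo a b))
  /-- `u ∈ L^∞(a, b; L²(Ω))`. -/
  energy_bound : ∃ M : ℝ≥0, ∀ᵐ t ∂(volume.restrict (Ioo a b)),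
    eLpNorm (fun x => u (x, t)) 2 (volume.restrict Ω) ≤ M
  /-- `u ∈ L²(a, b; W^{1,2}(Ω))`, first part: for a.e. time, `Du` is the weak gradient of `u`. -/
  weak_gradient : ∀ᵐ t ∂(volume.restrict (Ioo a b)), ∀ i,
    IsWeakGradient Ω (fun x => u (x, t) i) (fun j x => Du (x, t) i j)
  /-- `u ∈ L²(a, b; W^{1,2}(Ω))`, second part: `u` and its weak gradient are square integrable. -/
  memLp_u : MemLp u 2 (volume.restrict (Ω ×ˢ Ioo a b))
  memLp_Du : ∀ i j, MemLp (fun z => Du z i j) 2 (volume.restrict (Ω ×ˢ Ioo a b))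
  /-- `p ∈ L^{3/2}(Ω × (a, b))`. -/
  memLp_p : MemLp p (3 / 2) (volume.restrict (Ω ×ˢ Ioo a b))
  /-- The momentum equation, in the sense of distributions. -/
  momentum : ∀ ψ : SpaceTime → Space, IsTestFunction (Ω ×ˢ Ioo a b) ψ →
    ∫ z in Ω ×ˢ Ioo a b,
      (- (∑ i, u z i * timeDeriv ψ z i)
        + (∑ i, ∑ j, Du z i j * spaceDeriv j ψ z i)
        - (∑ i, ∑ j, u z i * u z j * spaceDeriv j ψ z i)
        - p z * ∑ i, spaceDeriv i ψ z i) = 0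
  /-- `u(·, t)` is weakly divergence free for a.e. time. -/
  divergence_free : ∀ᵐ t ∂(volume.restrict (Ioo a b)), ∀ φ : Space → ℝ, IsTestFunction Ω φ →
    ∫ x in Ω, ∑ j, u (x, t) j * fderiv ℝ φ x (unitVec j) = 0
  /-- The local generalized energy inequality. -/
  energy_inequality : ∀ᵐ t ∂(volume.restrict (Ioo a b)), ∀ φ : SpaceTime → ℝ,
    ContDiff ℝ ∞ φ → HasCompactSupport φ → (∀ z, 0 ≤ φ z) →
    (∀ᶠ z in 𝓝ˢ (parabolicBoundary Ω a b), φ z = 0) →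
    (∫ x in Ω, ‖u (x, t)‖ ^ 2 * φ (x, t)) + 2 * ∫ z in Ω ×ˢ Ioo a t, frobSq (Du z) * φ z
      ≤ (∫ z in Ω ×ˢ Ioo a t, ‖u z‖ ^ 2 * (timeDeriv φ z + spaceLaplacian φ z))
        + ∫ z in Ω ×ˢ Ioo a t, (‖u z‖ ^ 2 + 2 * p z) * ∑ j, u z j * spaceDeriv j φ z

/-! The scale invariant quantities, with values in `[0, ∞]`. -/

/-- `A(u, z₀, r) = sup_{t₀ - r² ≤ t ≤ t₀} r⁻¹ ∫_{B_r(x₀)} |u(x,t)|² dx`; the supremum is the essential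
one, since `u` is only determined almost everywhere. -/
def scaledA (u : SpaceTime → Space) (z₀ : SpaceTime) (r : ℝ) : ℝ≥0∞ :=
  essSup (fun t => ENNReal.ofReal r⁻¹ * ∫⁻ x in Metric.ball z₀.1 r, ‖u (x, t)‖ₑ ^ 2)
    (volume.restrict (Icc (z₀.2 - r ^ 2) z₀.2))

/-- `B(u, z₀, r) = r⁻¹ ∫_{Q_r(z₀)} |∇u|² dx dt`, as a function of the gradient `Du` of `u`. -/
def scaledB (Du : SpaceTime → Fin 3 → Fin 3 → ℝ) (z₀ : SpaceTime) (r : ℝ) : ℝ≥0∞ :=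
  ENNReal.ofReal r⁻¹ * ∫⁻ z in Metric.ball z₀.1 r ×ˢ Ioo (z₀.2 - r ^ 2) z₀.2,
    ENNReal.ofReal (frobSq (Du z))

/-- `C_{α,β}(u, z₀, r) = r^{-3β/2} ∫_{t₀-r²}^{t₀} ‖u‖_{L^{2α}(B_r(x₀))}^{2β} dt`. -/
def scaledC (α β : ℝ) (u : SpaceTime → Space) (z₀ : SpaceTime) (r : ℝ) : ℝ≥0∞ :=
  ENNReal.ofReal (r ^ (-(3 * β / 2))) * ∫⁻ t in Ioo (z₀.2 - r ^ 2) z₀.2,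
    eLpNorm (fun x => u (x, t)) (ENNReal.ofReal (2 * α))
      (volume.restrict (Metric.ball z₀.1 r)) ^ (2 * β)

/-- `D_{α,β}(p, z₀, r) = r^{-3β/2} ∫_{t₀-r²}^{t₀} ‖p‖_{L^α(B_r(x₀))}^β dt`. -/
def scaledD (α β : ℝ) (p : SpaceTime → ℝ) (z₀ : SpaceTime) (r : ℝ) : ℝ≥0∞ :=
  ENNReal.ofReal (r ^ (-(3 * β / 2))) * ∫⁻ t in Ioo (z₀.2 - r ^ 2) z₀.2,
    eLpNorm (fun x => p (x, t)) (ENNReal.ofReal α)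
      (volume.restrict (Metric.ball z₀.1 r)) ^ β

end NavierStokes

end

/-! The local energy inequality is tested with `ψ ^ 2`, where `ψ` is a parabolic cutoff between
`Q_{r/2}` and `Q_r`. The heat term is at most `L / r ^ 2` times the integral of `|u|²`. Since `∇(ψ²)
= 2ψ∇ψ`, the flux term keeps one factor `ψ` and is bounded by a multiple of `r⁻¹ ∫ (|u|² + 2|p|)
ψ|u|`.

The product `ψ|u|` lies in `L^∞ L² ∩ L² L⁶`, by the energy class and the Sobolev inequality applied
to `ψu` on time slices. The relation `3/α + 2/β = 7/2` says precisely that the dual of `L^β L^α` is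
an interpolation space between these two: with `1/α = 1/2 + 2κ/3` and `1/β = 1 - κ`, the range `6/5
≤ α ≤ 2` becomes `0 ≤ κ ≤ 1/2`. Pairing `|u|²` and `p` with `ψ|u|` therefore costs their mixed norms
times `W^{1/2}`, where `W` is the energy of `ψu` plus a multiple of `r⁻² ∫ |u|²`
(`lintegral_prod_mul_le_interpolation`).

The result has the form `W ≤ P + B √W`. Both sides involve the same cutoff on the same cylinder, so
`W`, being finite, is absorbed at once (`le_of_le_add_mul_sqrt`), without iterating over radii. `P`
is linear in the mixed norm of `|u|²` by Hölder and gives the power `1/β`; `B²` is quadratic and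
gives the powers `2/β` (`exists_cutoffEnergy_le`). The powers of `r` then match by scaling. -/

noncomputable section

namespace NavierStokes

/-! ### The Sobolev inequality for weak gradients, by mollification -/

section Sobolev

open scoped Convolution

/-- Jensen's inequality for mollification: it does not increase the `L²` norm. -/
theorem lintegral_sq_convolution_normed_le (ρ : ContDiffBump (0 : Space)) {f : Space → ℝ}
    (hf : AEStronglyMeasurable f volume) :
    ∫⁻ x, ‖(ρ.normed volume ⋆[ContinuousLinearMap.lsmul ℝ ℝ, volume] f) x‖ₑ ^ 2
      ≤ ∫⁻ x, ‖f x‖ₑ ^ 2 := by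
  have hρ : ∫⁻ t, ‖ρ.normed volume t‖ₑ = 1 := by
    have h := ofReal_integral_eq_lintegral_ofReal (ρ.integrable_normed (μ := volume))
      (Eventually.of_forall fun x => ρ.nonneg_normed x)
    rw [ρ.integral_normed, ENNReal.ofReal_one] at h
    rw [h]
    refine lintegral_congr fun t => ?_
    rw [Real.enorm_eq_ofReal (ρ.nonneg_normed t)]
  have hρm : Measurable fun t => ‖ρ.normed volume t‖ₑ :=
    (ρ.continuous_normed (μ := volume)).enorm.measurable
  have hm2 : AEMeasurable (fun z : Space × Space => ‖f (z.1 - z.2)‖ₑ ^ 2)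
      (volume.prod volume) :=
    (hf.comp_quasiMeasurePreserving
      (quasiMeasurePreserving_sub_of_right_invariant volume volume)).enorm.pow_const 2
  have key : ∀ x, AEMeasurable (fun t => ‖f (x - t)‖ₑ ^ 2) volume →
      ‖(ρ.normed volume ⋆[ContinuousLinearMap.lsmul ℝ ℝ, volume] f) x‖ₑ ^ 2
      ≤ ∫⁻ t, ‖ρ.normed volume t‖ₑ * ‖f (x - t)‖ₑ ^ 2 := by
    intro x hx
    -- Splitting the kernel as `ρ^{1/2} · ρ^{1/2}` lets Cauchy–Schwarz use that it has mass one.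
    have h1 : ‖(ρ.normed volume ⋆[ContinuousLinearMap.lsmul ℝ ℝ, volume] f) x‖ₑ
        ≤ ∫⁻ t, (‖ρ.normed volume t‖ₑ) ^ (1 / 2 : ℝ)
          * (‖ρ.normed volume t‖ₑ * ‖f (x - t)‖ₑ ^ 2) ^ (1 / 2 : ℝ) := by
      refine (enorm_integral_le_lintegral_enorm _).trans (lintegral_mono fun t => le_of_eq ?_)
      rw [ContinuousLinearMap.lsmul_apply, enorm_smul, ENNReal.mul_rpow_of_nonneg _ _ (by norm_num),
        ← mul_assoc, ← ENNReal.rpow_add_of_nonneg _ _ (by norm_num) (by norm_num),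
        ← ENNReal.rpow_natCast, ← ENNReal.rpow_mul]
      norm_num
    have h2 := h1.trans (ENNReal.lintegral_mul_norm_pow_le hρm.aemeasurable
      (hρm.aemeasurable.mul hx) (p := 1 / 2) (q := 1 / 2) (by norm_num) (by norm_num)
      (by norm_num))
    rw [hρ, ENNReal.one_rpow, one_mul] at h2
    calc _ ≤ ((∫⁻ t, ‖ρ.normed volume t‖ₑ * ‖f (x - t)‖ₑ ^ 2) ^ (1 / 2 : ℝ)) ^ 2 :=
          pow_le_pow_left' h2 2
      _ = _ := by
        rw [← ENNReal.rpow_natCast, ← ENNReal.rpow_mul]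
        norm_num
  calc _ ≤ ∫⁻ x, ∫⁻ t, ‖ρ.normed volume t‖ₑ * ‖f (x - t)‖ₑ ^ 2 := by
        refine lintegral_mono fun x => key x ?_
        exact (hf.comp_quasiMeasurePreserving
          (quasiMeasurePreserving_sub_left volume x)).enorm.pow_const 2
    _ = ∫⁻ t, ∫⁻ x, ‖ρ.normed volume t‖ₑ * ‖f (x - t)‖ₑ ^ 2 := by
        refine lintegral_lintegral_swap ?_
        exact (hρm.comp measurable_snd).aemeasurable.mul hm2
    _ = ∫⁻ t, ‖ρ.normed volume t‖ₑ * ∫⁻ x, ‖f x‖ₑ ^ 2 := by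
        refine lintegral_congr fun t => ?_
        rw [lintegral_const_mul' _ _ enorm_ne_top,
          lintegral_sub_right_eq_self (fun x => ‖f x‖ₑ ^ 2) t]
    _ = _ := by rw [lintegral_mul_const _ hρm, hρ, one_mul]

/-- The classical derivative of a mollification is the mollification of the weak gradient. -/
theorem fderiv_convolution_normed_of_isWeakGradient (ρ : ContDiffBump (0 : Space)) {f : Space → ℝ}
    {G : Fin 3 → Space → ℝ} (hf : LocallyIntegrable f volume)
    (h : IsWeakGradient univ f G) (x : Space) (j : Fin 3) :
    fderiv ℝ (ρ.normed volume ⋆[ContinuousLinearMap.lsmul ℝ ℝ, volume] f) x (unitVec j)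
      = (ρ.normed volume ⋆[ContinuousLinearMap.lsmul ℝ ℝ, volume] G j) x := by
  have hcs : HasCompactSupport (ρ.normed (volume : Measure Space)) := ρ.hasCompactSupport_normed
  have hcd : ContDiff ℝ ∞ (ρ.normed (volume : Measure Space)) := ρ.contDiff_normed
  have h1 : ContDiff ℝ 1 (ρ.normed (volume : Measure Space)) := ρ.contDiff_normed
  rw [(hcs.hasFDerivAt_convolution_left (ContinuousLinearMap.lsmul ℝ ℝ) h1 hf x).fderiv]
  have hex := (hcs.fderiv ℝ).convolutionExists_left
    ((ContinuousLinearMap.lsmul ℝ ℝ : ℝ →L[ℝ] ℝ →L[ℝ] ℝ).precompL Space)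
    (h1.continuous_fderiv one_ne_zero) hf x
  rw [convolution_eq_swap, ContinuousLinearMap.integral_apply hex.integrable_swap,
    convolution_eq_swap]
  -- The reflected and translated bump is the test function; the sign from reflection cancels the
  -- one in the definition of the weak gradient.
  set φ : Space → ℝ := fun t => ρ.normed volume (x - t) with hφ
  have hφt : IsTestFunction univ φ := by
    refine ⟨hcd.comp (contDiff_const.sub contDiff_id), ?_, subset_univ _⟩
    exact hcs.comp_homeomorph (Homeomorph.subLeft x)
  have hd : ∀ t, fderiv ℝ φ t (unitVec j) = - fderiv ℝ (ρ.normed volume) (x - t) (unitVec j) := by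
    intro t
    have := ((h1.differentiable one_ne_zero (x - t)).hasFDerivAt).comp t
      ((hasFDerivAt_const x t).sub (hasFDerivAt_id t))
    have h2 : HasFDerivAt φ _ t := this
    rw [h2.fderiv]
    simp
  have hw := h φ hφt j
  simp only [Measure.restrict_univ, hd, mul_neg, integral_neg, neg_inj] at hw
  simp only [ContinuousLinearMap.precompL_apply, ContinuousLinearMap.lsmul_apply, smul_eq_mul]
  simp only [mul_comm (fderiv ℝ _ _ _), hw, hφ, mul_comm (G j _)]

theorem norm_le_sum_unitVec (L : Space →L[ℝ] ℝ) : ‖L‖ ≤ ∑ j, ‖L (unitVec j)‖ := by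
  refine L.opNorm_le_bound (by positivity) fun x => ?_
  have hx : x = ∑ j, x j • unitVec j := by
    ext i
    simp [unitVec, Fin.sum_univ_three]
    fin_cases i <;> simp
  calc ‖L x‖ = ‖∑ j, x j * L (unitVec j)‖ := by
        conv_lhs => rw [hx]
        simp
    _ ≤ ∑ j, ‖x j * L (unitVec j)‖ := norm_sum_le _ _
    _ ≤ ∑ j, ‖L (unitVec j)‖ * ‖x‖ := by
        gcongr with j
        rw [norm_mul, mul_comm]
        gcongr
        exact PiLp.norm_apply_le x j
    _ = _ := by rw [Finset.sum_mul]

theorem enorm_sq_le_sum_unitVec (L : Space →L[ℝ] ℝ) :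
    ‖L‖ₑ ^ 2 ≤ 3 * ∑ j, ‖L (unitVec j)‖ₑ ^ 2 := by
  have h : ‖L‖ ^ 2 ≤ 3 * ∑ j, ‖L (unitVec j)‖ ^ 2 := by
    have h1 := norm_le_sum_unitVec L
    calc ‖L‖ ^ 2 ≤ (∑ j, ‖L (unitVec j)‖) ^ 2 := by gcongr
      _ ≤ _ := by
        have := sq_sum_le_card_mul_sum_sq (s := Finset.univ) (f := fun j => ‖L (unitVec j)‖)
        simpa using this
  have h2 := ENNReal.ofReal_le_ofReal h
  rw [ENNReal.ofReal_pow (norm_nonneg _), ENNReal.ofReal_mul (by norm_num),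
    ENNReal.ofReal_sum_of_nonneg (fun _ _ => by positivity)] at h2
  simpa only [ENNReal.ofReal_pow (norm_nonneg _), ofReal_norm, ENNReal.ofReal_ofNat] using h2

/-- The Gagliardo-Nirenberg-Sobolev inequality `‖f‖₆ ≤ C ‖∇f‖₂` for compactly supported `C¹`
functions. -/
theorem exists_lintegral_pow_six_le_fderiv : ∃ K : ℝ≥0, ∀ f : Space → ℝ, ContDiff ℝ 1 f →
    HasCompactSupport f →
    ∫⁻ x, ‖f x‖ₑ ^ 6 ≤ (K * ∑ j, ∫⁻ x, ‖fderiv ℝ f x (unitVec j)‖ₑ ^ 2) ^ 3 := by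
  set c := SNormLESNormFDerivOfEqConst ℝ (volume : Measure Space) (2 : ℝ≥0) with hc
  -- The Sobolev constant enters squared; the 3 comes from comparing the operator norm of the
  -- derivative with its three components.
  refine ⟨c ^ 2 * 3, fun f hf hfs => ?_⟩
  have h := eLpNorm_le_eLpNorm_fderiv_of_eq (μ := (volume : Measure Space)) (p := 2) (p' := 6)
    hf hfs (by norm_num) (by simp) (by norm_num [finrank_euclideanSpace])
  rw [eLpNorm_eq_lintegral_rpow_enorm_toReal (by norm_num) (by norm_num),
    eLpNorm_eq_lintegral_rpow_enorm_toReal (by norm_num) (by norm_num)] at h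
  have h6 : ∀ x : ℝ≥0∞, x ^ (6 : ℝ) = x ^ 6 := fun x => by
    rw [← ENNReal.rpow_natCast]; norm_num
  simp only [ENNReal.coe_ofNat, ENNReal.toReal_ofNat, ENNReal.rpow_ofNat, h6] at h
  have h' := pow_le_pow_left' h 6
  rw [mul_pow, ← ENNReal.rpow_natCast, ← ENNReal.rpow_mul, ← ENNReal.rpow_natCast (_ ^ _),
    ← ENNReal.rpow_mul] at h'
  norm_num at h'
  refine h'.trans ?_
  rw [show (6 : ℕ) = 2 * 3 by norm_num, pow_mul, ← mul_pow]
  refine pow_le_pow_left' ?_ 3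
  push_cast
  rw [mul_assoc]
  refine mul_le_mul' le_rfl ?_
  have hcont : ∀ j : Fin 3, Measurable fun x => ‖fderiv ℝ f x (unitVec j)‖ₑ ^ 2 := fun j =>
    ((((hf.continuous_fderiv one_ne_zero).clm_apply continuous_const).enorm).measurable).pow_const 2
  calc _ ≤ ∫⁻ x, 3 * ∑ j, ‖fderiv ℝ f x (unitVec j)‖ₑ ^ 2 :=
        lintegral_mono fun x => enorm_sq_le_sum_unitVec _
    _ = _ := by
      rw [lintegral_const_mul _ (Finset.measurable_sum _ fun j _ => hcont j),
        lintegral_finsetSum _ fun j _ => hcont j]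

/-- The Sobolev inequality for compactly supported functions with a weak gradient. -/
theorem exists_lintegral_pow_six_le_weakGradient : ∃ K : ℝ≥0, ∀ (f : Space → ℝ)
    (G : Fin 3 → Space → ℝ), LocallyIntegrable f volume → HasCompactSupport f →
    (∀ j, AEStronglyMeasurable (G j) volume) → IsWeakGradient univ f G →
    ∫⁻ x, ‖f x‖ₑ ^ 6 ≤ (K * ∑ j, ∫⁻ x, ‖G j x‖ₑ ^ 2) ^ 3 := by
  obtain ⟨K, hK⟩ := exists_lintegral_pow_six_le_fderiv
  refine ⟨K, fun f G hf hfs hG h => ?_⟩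
  -- The fixed ratio 2 between outer and inner radius is what the almost everywhere convergence of
  -- mollifications requires.
  let ρ : ℕ → ContDiffBump (0 : Space) := fun n =>
    { rIn := 1 / (n + 1 : ℝ)
      rOut := 2 * (1 / (n + 1 : ℝ))
      rIn_pos := by positivity
      rIn_lt_rOut := by
        have : 0 < 1 / (n + 1 : ℝ) := by positivity
        linarith }
  have hlim := ContDiffBump.ae_convolution_tendsto_right_of_locallyIntegrable (φ := ρ)
    (l := atTop) (K := 2) (μ := volume) (g := f)
    (by simpa [ρ] using (tendsto_one_div_add_atTop_nhds_zero_nat (𝕜 := ℝ)).const_mul 2)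
    (Eventually.of_forall fun n => le_rfl) hf
  set F : ℕ → Space → ℝ := fun n =>
    (ρ n).normed volume ⋆[ContinuousLinearMap.lsmul ℝ ℝ, volume] f with hF
  have hFcd : ∀ n, ContDiff ℝ 1 (F n) := fun n =>
    (ρ n).hasCompactSupport_normed.contDiff_convolution_left (n := 1) _ (ρ n).contDiff_normed hf
  have hFcs : ∀ n, HasCompactSupport (F n) := fun n =>
    (ρ n).hasCompactSupport_normed.convolution _ hfs
  have hb : ∀ n, ∫⁻ x, ‖F n x‖ₑ ^ 6 ≤ (K * ∑ j, ∫⁻ x, ‖G j x‖ₑ ^ 2) ^ 3 := by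
    intro n
    refine (hK _ (hFcd n) (hFcs n)).trans ?_
    refine pow_le_pow_left' (mul_le_mul_right (Finset.sum_le_sum fun j _ => ?_) _) 3
    simp only [hF, fderiv_convolution_normed_of_isWeakGradient (ρ n) hf h]
    exact lintegral_sq_convolution_normed_le (ρ n) (hG j)
  -- Fatou's lemma transfers the bound, which is uniform in `n`, to the almost everywhere limit.
  calc ∫⁻ x, ‖f x‖ₑ ^ 6 = ∫⁻ x, liminf (fun n => ‖F n x‖ₑ ^ 6) atTop := by
        refine lintegral_congr_ae ?_
        filter_upwards [hlim] with x hx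
        exact (((ENNReal.continuous_pow 6).tendsto _).comp hx.enorm).liminf_eq.symm
    _ ≤ liminf (fun n => ∫⁻ x, ‖F n x‖ₑ ^ 6) atTop :=
        lintegral_liminf_le fun n => ((hFcd n).continuous.enorm.measurable).pow_const 6
    _ ≤ _ := liminf_le_of_le (by isBoundedDefault) fun b hb' => by
        obtain ⟨n, hn⟩ := hb'.exists
        exact hn.trans (hb n)

end Sobolev

/-! ### Localized Sobolev inequality for scalar and vector fields -/

section LocalSobolev

theorem IsTestFunction.eq_zero_of_notMem {X F : Type*} [NormedAddCommGroup X] [NormedSpace ℝ X]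
    [NormedAddCommGroup F] [NormedSpace ℝ F] {U : Set X} {f : X → F} (h : IsTestFunction U f)
    {x : X} (hx : x ∉ U) : f x = 0 :=
  image_eq_zero_of_notMem_tsupport fun h' => hx (h.2.2 h')

theorem IsTestFunction.fderiv_eq_zero_of_notMem {X F : Type*} [NormedAddCommGroup X]
    [NormedSpace ℝ X] [NormedAddCommGroup F] [NormedSpace ℝ F] {U : Set X} {f : X → F}
    (h : IsTestFunction U f) {x : X} (hx : x ∉ U) : fderiv ℝ f x = 0 :=
  image_eq_zero_of_notMem_tsupport fun h' => hx (h.2.2 (tsupport_fderiv_subset ℝ h'))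

/-- Multiplication by a test function turns a weak gradient on `Ω` into one on the whole space. -/
theorem IsWeakGradient.mul_testFunction {Ω : Set Space} {f : Space → ℝ}
    {G : Fin 3 → Space → ℝ} (h : IsWeakGradient Ω f G)
    (hf : MemLp f 2 (volume.restrict Ω)) (hG : ∀ j, MemLp (G j) 2 (volume.restrict Ω))
    {η : Space → ℝ} (hη : IsTestFunction Ω η) :
    IsWeakGradient univ (fun x => η x * f x)
      (fun j x => η x * G j x + fderiv ℝ η x (unitVec j) * f x) := by
  intro φ hφ j
  have hηd : Differentiable ℝ η := hη.1.differentiable (by simp)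
  have hφd : Differentiable ℝ φ := hφ.1.differentiable (by simp)
  -- Although `φ` need not vanish near the boundary of `Ω`, the product `η φ` is admissible there;
  -- the product rule then produces the extra term `f ∂_j η`.
  have hηφ : IsTestFunction Ω (fun x => η x * φ x) :=
    ⟨hη.1.mul hφ.1, hη.2.1.mul_right, (tsupport_mul_subset_left).trans hη.2.2⟩
  have hw := h _ hηφ j
  have hL2 : ∀ ζ : Space → ℝ, Continuous ζ → HasCompactSupport ζ →
      MemLp ζ 2 (volume.restrict Ω) := fun ζ h1 h2 =>
    (h1.memLp_of_hasCompactSupport h2).restrict Ω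
  have hint : ∀ g ζ : Space → ℝ, MemLp g 2 (volume.restrict Ω) → Continuous ζ →
      HasCompactSupport ζ → Integrable (fun x => g x * ζ x) (volume.restrict Ω) :=
    fun g ζ hg h1 h2 => hg.integrable_mul (hL2 ζ h1 h2)
  have hcd : ∀ ζ : Space → ℝ, ContDiff ℝ ∞ ζ → Continuous fun x => fderiv ℝ ζ x (unitVec j) :=
    fun ζ hζ => (hζ.continuous_fderiv (by simp)).clm_apply continuous_const
  have hcs : HasCompactSupport fun x => fderiv ℝ η x (unitVec j) :=
    hη.2.1.fderiv_apply ℝ (unitVec j)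
  have hI1 := hint f (fun x => η x * fderiv ℝ φ x (unitVec j)) hf
    (hη.1.continuous.mul (hcd φ hφ.1)) hη.2.1.mul_right
  have hI2 := hint f (fun x => fderiv ℝ η x (unitVec j) * φ x) hf
    ((hcd η hη.1).mul hφ.1.continuous) hcs.mul_right
  have hI3 := hint (G j) (fun x => η x * φ x) (hG j)
    (hη.1.continuous.mul hφ.1.continuous) hη.2.1.mul_right
  have hd : ∀ x, f x * fderiv ℝ (fun x => η x * φ x) x (unitVec j)
      = f x * (η x * fderiv ℝ φ x (unitVec j)) + f x * (fderiv ℝ η x (unitVec j) * φ x) := by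
    intro x
    rw [fderiv_fun_mul (hηd x) (hφd x)]
    simp
    ring
  simp only [hd] at hw
  rw [integral_add hI1 hI2] at hw
  have hout : ∀ g : Space → ℝ, (∀ x ∉ Ω, g x = 0) → ∫ x, g x = ∫ x in Ω, g x := fun g hg =>
    (setIntegral_eq_integral_of_forall_compl_eq_zero hg).symm
  rw [Measure.restrict_univ, hout _ fun x hx => by simp [hη.eq_zero_of_notMem hx],
    hout _ fun x hx => by simp [hη.eq_zero_of_notMem hx, hη.fderiv_eq_zero_of_notMem hx]]
  have e1 : ∫ x in Ω, η x * f x * fderiv ℝ φ x (unitVec j)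
      = ∫ x in Ω, f x * (η x * fderiv ℝ φ x (unitVec j)) := by
    congr 1; ext x; ring
  have e2 : ∫ x in Ω, (η x * G j x + fderiv ℝ η x (unitVec j) * f x) * φ x
      = (∫ x in Ω, G j x * (η x * φ x)) + ∫ x in Ω, f x * (fderiv ℝ η x (unitVec j) * φ x) := by
    rw [← integral_add hI3 hI2]
    congr 1; ext x; ring
  rw [e1, e2]
  linarith

/-- Local Sobolev inequality: the `L⁶` norm of `η f` is controlled by the `L²` norms of `η ∇f` and
`f ∇η`. -/
theorem exists_lintegral_mul_testFunction_pow_six_le : ∃ K : ℝ≥0, ∀ (Ω : Set Space), IsOpen Ω →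
    ∀ (f : Space → ℝ) (G : Fin 3 → Space → ℝ), MemLp f 2 (volume.restrict Ω) →
    (∀ j, MemLp (G j) 2 (volume.restrict Ω)) → IsWeakGradient Ω f G →
    ∀ η : Space → ℝ, IsTestFunction Ω η → ∀ L : ℝ≥0, (∀ x j, ‖fderiv ℝ η x (unitVec j)‖ₑ ≤ L) →
    ∫⁻ x in Ω, (‖η x‖ₑ * ‖f x‖ₑ) ^ 6 ≤ (K * ((∑ j, ∫⁻ x in Ω, ‖η x‖ₑ ^ 2 * ‖G j x‖ₑ ^ 2)
      + L ^ 2 * ∫⁻ x in Ω, ‖f x‖ₑ ^ 2)) ^ 3 := by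
  obtain ⟨K, hK⟩ := exists_lintegral_pow_six_le_weakGradient
  -- A factor 2 from `(a + b)² ≤ 2a² + 2b²`, and 3 because the term with `L` occurs once for each
  -- `j`.
  refine ⟨K * 6, fun Ω hΩ f G hf hG h η hη L hL => ?_⟩
  -- Measurability is known only on `Ω`; functions vanishing outside it are measurable on the whole
  -- space.
  have hm : ∀ g : Space → ℝ, (∀ x ∉ Ω, g x = 0) → AEStronglyMeasurable g (volume.restrict Ω) →
      AEStronglyMeasurable g volume := by
    intro g hg hgm
    have := (aestronglyMeasurable_indicator_iff hΩ.measurableSet).2 hgm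
    rwa [indicator_eq_self.2] at this
    intro x hx
    by_contra hx'
    exact hx (hg x hx')
  have hcd : ∀ j, Continuous fun x => fderiv ℝ η x (unitVec j) :=
    fun j => (hη.1.continuous_fderiv (by simp)).clm_apply continuous_const
  have hηm : AEStronglyMeasurable η (volume.restrict Ω) := hη.1.continuous.aestronglyMeasurable
  have hI : Integrable (fun x => η x * f x) volume := by
    have h1 : Integrable (fun x => η x * f x) (volume.restrict Ω) :=
      ((hη.1.continuous.memLp_of_hasCompactSupport (p := 2) hη.2.1).restrict Ω).integrable_mul hf
    have h2 := (integrable_indicator_iff hΩ.measurableSet).2 h1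
    rwa [indicator_eq_self.2] at h2
    intro x hx
    by_contra hx'
    exact hx (by simp [hη.eq_zero_of_notMem hx'])
  have key := hK (fun x => η x * f x) (fun j x => η x * G j x + fderiv ℝ η x (unitVec j) * f x)
    hI.locallyIntegrable hη.2.1.mul_right
    (fun j => hm _ (fun x hx => by simp [hη.eq_zero_of_notMem hx, hη.fderiv_eq_zero_of_notMem hx])
      ((hηm.mul (hG j).1).add ((hcd j).aestronglyMeasurable.mul hf.1)))
    (h.mul_testFunction hf hG hη)
  simp only [enorm_mul] at key
  refine (setLIntegral_le_lintegral _ _).trans (key.trans (pow_le_pow_left' ?_ 3))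
  have hj : ∀ j, ∫⁻ x, ‖η x * G j x + fderiv ℝ η x (unitVec j) * f x‖ₑ ^ 2
      ≤ 2 * (∫⁻ x in Ω, ‖η x‖ₑ ^ 2 * ‖G j x‖ₑ ^ 2) + 2 * (L ^ 2 * ∫⁻ x in Ω, ‖f x‖ₑ ^ 2) := by
    intro j
    have hs : ∫⁻ x, ‖η x * G j x + fderiv ℝ η x (unitVec j) * f x‖ₑ ^ 2
        = ∫⁻ x in Ω, ‖η x * G j x + fderiv ℝ η x (unitVec j) * f x‖ₑ ^ 2 := by
      refine (setLIntegral_eq_of_support_subset (Function.support_subset_iff'.2 fun x hx => ?_)).symm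
      simp [hη.eq_zero_of_notMem hx, hη.fderiv_eq_zero_of_notMem hx]
    have hpt : ∀ x, ‖η x * G j x + fderiv ℝ η x (unitVec j) * f x‖ₑ ^ 2
        ≤ 2 * (‖η x‖ₑ ^ 2 * ‖G j x‖ₑ ^ 2) + 2 * (L ^ 2 * ‖f x‖ₑ ^ 2) := by
      intro x
      calc _ ≤ (‖η x * G j x‖ₑ + ‖fderiv ℝ η x (unitVec j) * f x‖ₑ) ^ 2 :=
            pow_le_pow_left' (enorm_add_le _ _) 2
        _ ≤ (‖η x‖ₑ * ‖G j x‖ₑ + L * ‖f x‖ₑ) ^ 2 := by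
            rw [enorm_mul, enorm_mul]
            gcongr
            exact hL x j
        _ ≤ _ := by
          have := ENNReal.rpow_add_le_mul_rpow_add_rpow (‖η x‖ₑ * ‖G j x‖ₑ) (L * ‖f x‖ₑ)
            (p := 2) (by norm_num)
          norm_num at this
          rwa [mul_pow, mul_pow, mul_add] at this
    rw [hs]
    refine (lintegral_mono hpt).trans (le_of_eq ?_)
    rw [lintegral_add_left', lintegral_const_mul' _ _ (by simp), lintegral_const_mul' _ _ (by simp),
      lintegral_const_mul' _ _ (by simp)]
    exact ((hηm.enorm.pow_const 2).mul ((hG j).1.enorm.pow_const 2)).const_mul 2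
  calc (K : ℝ≥0∞) * ∑ j, ∫⁻ x, ‖η x * G j x + fderiv ℝ η x (unitVec j) * f x‖ₑ ^ 2
      ≤ K * ∑ j, (2 * (∫⁻ x in Ω, ‖η x‖ₑ ^ 2 * ‖G j x‖ₑ ^ 2)
        + 2 * (L ^ 2 * ∫⁻ x in Ω, ‖f x‖ₑ ^ 2)) := by
        gcongr with j
        exact hj j
    _ = K * (2 * (∑ j, ∫⁻ x in Ω, ‖η x‖ₑ ^ 2 * ‖G j x‖ₑ ^ 2)
          + 6 * (L ^ 2 * ∫⁻ x in Ω, ‖f x‖ₑ ^ 2)) := by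
        rw [Finset.sum_add_distrib, ← Finset.mul_sum]
        simp
        ring
    _ ≤ K * (6 * (∑ j, ∫⁻ x in Ω, ‖η x‖ₑ ^ 2 * ‖G j x‖ₑ ^ 2)
          + 6 * (L ^ 2 * ∫⁻ x in Ω, ‖f x‖ₑ ^ 2)) := by
        gcongr
        norm_num
    _ = _ := by push_cast; ring

theorem enorm_sq_eq_sum (v : Space) : ‖v‖ₑ ^ 2 = ∑ i, ‖v i‖ₑ ^ 2 := by
  have h := congrArg ENNReal.ofReal (EuclideanSpace.norm_sq_eq v)
  rw [ENNReal.ofReal_sum_of_nonneg (fun _ _ => by positivity)] at h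
  simpa only [ENNReal.ofReal_pow (norm_nonneg _), ofReal_norm] using h

theorem ofReal_frobSq (M : Fin 3 → Fin 3 → ℝ) :
    ENNReal.ofReal (frobSq M) = ∑ i, ∑ j, ‖M i j‖ₑ ^ 2 := by
  rw [frobSq, ENNReal.ofReal_sum_of_nonneg (fun _ _ => by positivity)]
  refine Finset.sum_congr rfl fun i _ => ?_
  rw [ENNReal.ofReal_sum_of_nonneg (fun _ _ => by positivity)]
  refine Finset.sum_congr rfl fun j _ => ?_
  rw [← ofReal_norm, ← ENNReal.ofReal_pow (norm_nonneg _), Real.norm_eq_abs, sq_abs]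

/-- Local Sobolev inequality for vector fields. -/
theorem exists_lintegral_vector_pow_six_le : ∃ K : ℝ≥0, ∀ (Ω : Set Space), IsOpen Ω →
    ∀ (u : Space → Space) (Du : Space → Fin 3 → Fin 3 → ℝ), MemLp u 2 (volume.restrict Ω) →
    (∀ i j, MemLp (fun x => Du x i j) 2 (volume.restrict Ω)) →
    (∀ i, IsWeakGradient Ω (fun x => u x i) (fun j x => Du x i j)) →
    ∀ η : Space → ℝ, IsTestFunction Ω η → ∀ L : ℝ≥0, (∀ x j, ‖fderiv ℝ η x (unitVec j)‖ₑ ≤ L) →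
    ∫⁻ x in Ω, (‖η x‖ₑ * ‖u x‖ₑ) ^ 6 ≤
      (K * ((∫⁻ x in Ω, ‖η x‖ₑ ^ 2 * ENNReal.ofReal (frobSq (Du x)))
        + L ^ 2 * ∫⁻ x in Ω, ‖u x‖ₑ ^ 2)) ^ 3 := by
  obtain ⟨K, hK⟩ := exists_lintegral_mul_testFunction_pow_six_le
  -- `27 = 3³`: convexity of the cube gives 9, and the sum over the three components gives another
  -- 3.
  refine ⟨3 * K, fun Ω hΩ u Du hu hDu h η hη L hL => ?_⟩
  have hui : ∀ i, MemLp (fun x => u x i) 2 (volume.restrict Ω) := fun i => hu.eval_piLp i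
  have hηm : AEMeasurable (fun x => ‖η x‖ₑ) (volume.restrict Ω) :=
    hη.1.continuous.enorm.measurable.aemeasurable
  have hi := fun i => hK Ω hΩ _ _ (hui i) (hDu i) (h i) η hη L hL
  set S : Fin 3 → ℝ≥0∞ := fun i => (∑ j, ∫⁻ x in Ω, ‖η x‖ₑ ^ 2 * ‖Du x i j‖ₑ ^ 2)
      + L ^ 2 * ∫⁻ x in Ω, ‖u x i‖ₑ ^ 2 with hS
  have hsum : (∫⁻ x in Ω, ‖η x‖ₑ ^ 2 * ENNReal.ofReal (frobSq (Du x)))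
        + L ^ 2 * ∫⁻ x in Ω, ‖u x‖ₑ ^ 2 = ∑ i, S i := by
    simp only [hS, ofReal_frobSq, enorm_sq_eq_sum, Finset.mul_sum, Finset.sum_add_distrib]
    have hm : ∀ i j, AEMeasurable (fun x => ‖η x‖ₑ ^ 2 * ‖Du x i j‖ₑ ^ 2) (volume.restrict Ω) :=
      fun i j => (hηm.pow_const 2).mul ((hDu i j).1.enorm.pow_const 2)
    rw [lintegral_finsetSum' _ fun i _ => Finset.aemeasurable_fun_sum _ fun j _ => hm i j,
      lintegral_finsetSum' _ fun i _ => (hui i).1.enorm.pow_const 2, Finset.mul_sum]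
    congr 1
    refine Finset.sum_congr rfl fun i _ => ?_
    rw [lintegral_finsetSum' _ fun j _ => hm i j]
  have hpt : ∀ x, (‖η x‖ₑ * ‖u x‖ₑ) ^ 6 ≤ 9 * ∑ i, (‖η x‖ₑ * ‖u x i‖ₑ) ^ 6 := by
    intro x
    have h1 := ENNReal.rpow_sum_le_const_mul_sum_rpow Finset.univ
      (fun i => (‖η x‖ₑ * ‖u x i‖ₑ) ^ 2) (p := 3) (by norm_num)
    have h2 : (‖η x‖ₑ * ‖u x‖ₑ) ^ 2 = ∑ i, (‖η x‖ₑ * ‖u x i‖ₑ) ^ 2 := by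
      simp only [mul_pow, enorm_sq_eq_sum, Finset.mul_sum]
    rw [← h2] at h1
    norm_num at h1
    simpa only [← pow_mul] using h1
  rw [hsum]
  calc ∫⁻ x in Ω, (‖η x‖ₑ * ‖u x‖ₑ) ^ 6
      ≤ ∫⁻ x in Ω, 9 * ∑ i, (‖η x‖ₑ * ‖u x i‖ₑ) ^ 6 := lintegral_mono hpt
    _ = 9 * ∑ i, ∫⁻ x in Ω, (‖η x‖ₑ * ‖u x i‖ₑ) ^ 6 := by
      rw [lintegral_const_mul' _ _ (by simp), lintegral_finsetSum']
      exact fun i _ => (hηm.mul (hui i).1.enorm).pow_const 6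
    _ ≤ 9 * ∑ i : Fin 3, (K * ∑ i, S i) ^ 3 := by
      gcongr with i
      refine (hi i).trans (pow_le_pow_left' (mul_le_mul_right ?_ _) 3)
      exact Finset.single_le_sum (f := S) (fun _ _ => zero_le) (Finset.mem_univ i)
    _ = _ := by
      simp
      ring

end LocalSobolev

/-! ### Parabolic rescaling and cutoff functions -/

section Cutoff

theorem fderiv_slice {f : SpaceTime → ℝ} (hf : Differentiable ℝ f) (x : Space) (t : ℝ)
    (j : Fin 3) : fderiv ℝ (fun y => f (y, t)) x (unitVec j) = spaceDeriv j f (x, t) := by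
  have h1 : HasFDerivAt (fun y : Space => (y, t)) (ContinuousLinearMap.inl ℝ Space ℝ) x :=
    hasFDerivAt_prodMk_left x t
  have h : HasFDerivAt (fun y => f (y, t)) _ x := (hf (x, t)).hasFDerivAt.comp x h1
  rw [h.fderiv]
  simp [spaceDeriv]

/-- The parabolic rescaling mapping `Q_r(z₀)` to `Q_1(0)`. -/
def parabolicScaling (z₀ : SpaceTime) (r : ℝ) (z : SpaceTime) : SpaceTime :=
  (r⁻¹ • (z.1 - z₀.1), (r ^ 2)⁻¹ * (z.2 - z₀.2))

theorem contDiff_parabolicScaling (z₀ : SpaceTime) (r : ℝ) :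
    ContDiff ℝ ∞ (parabolicScaling z₀ r) := by
  unfold parabolicScaling
  fun_prop

theorem fderiv_comp_parabolicScaling {f : SpaceTime → ℝ} (hf : Differentiable ℝ f)
    (z₀ : SpaceTime) (r : ℝ) (z v : SpaceTime) :
    fderiv ℝ (fun w => f (parabolicScaling z₀ r w)) z v
      = fderiv ℝ f (parabolicScaling z₀ r z) (r⁻¹ • v.1, (r ^ 2)⁻¹ * v.2) := by
  have h1 := ((hasFDerivAt_fst (𝕜 := ℝ) (p := z)).sub_const z₀.1).const_smul r⁻¹
  have h2 := ((hasFDerivAt_snd (𝕜 := ℝ) (p := z)).sub_const z₀.2).const_mul (r ^ 2)⁻¹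
  have h : HasFDerivAt (fun w => f (parabolicScaling z₀ r w)) _ z :=
    (hf (parabolicScaling z₀ r z)).hasFDerivAt.comp z (h1.prodMk h2)
  rw [h.fderiv]
  simp

theorem timeDeriv_comp_parabolicScaling {f : SpaceTime → ℝ} (hf : Differentiable ℝ f)
    (z₀ : SpaceTime) (r : ℝ) (z : SpaceTime) :
    timeDeriv (fun w => f (parabolicScaling z₀ r w)) z
      = (r ^ 2)⁻¹ * timeDeriv f (parabolicScaling z₀ r z) := by
  rw [timeDeriv, fderiv_comp_parabolicScaling hf, timeDeriv, ← smul_eq_mul (_)⁻¹ (fderiv ℝ _ _ _),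
    ← map_smul]
  simp

theorem spaceDeriv_comp_parabolicScaling {f : SpaceTime → ℝ} (hf : Differentiable ℝ f)
    (z₀ : SpaceTime) (r : ℝ) (z : SpaceTime) (j : Fin 3) :
    spaceDeriv j (fun w => f (parabolicScaling z₀ r w)) z
      = r⁻¹ * spaceDeriv j f (parabolicScaling z₀ r z) := by
  rw [spaceDeriv, fderiv_comp_parabolicScaling hf, spaceDeriv, ← smul_eq_mul (_)⁻¹ (fderiv ℝ _ _ _),
    ← map_smul]
  simp

theorem contDiff_spaceDeriv {f : SpaceTime → ℝ} (hf : ContDiff ℝ ∞ f) (j : Fin 3) :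
    ContDiff ℝ ∞ (spaceDeriv j f) :=
  (hf.fderiv_right (m := ∞) (by simp)).clm_apply contDiff_const

theorem contDiff_timeDeriv {f : SpaceTime → ℝ} (hf : ContDiff ℝ ∞ f) :
    ContDiff ℝ ∞ (timeDeriv f) :=
  (hf.fderiv_right (m := ∞) (by simp)).clm_apply contDiff_const

/-- Two space derivatives give the same factor `r⁻²` as one time derivative, so the heat operator
applied to the cutoff scales as a whole. -/
theorem spaceLaplacian_comp_parabolicScaling {f : SpaceTime → ℝ} (hf : ContDiff ℝ ∞ f)
    (z₀ : SpaceTime) (r : ℝ) (z : SpaceTime) :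
    spaceLaplacian (fun w => f (parabolicScaling z₀ r w)) z
      = (r ^ 2)⁻¹ * spaceLaplacian f (parabolicScaling z₀ r z) := by
  rw [spaceLaplacian, spaceLaplacian, Finset.mul_sum]
  refine Finset.sum_congr rfl fun j _ => ?_
  have h1 : spaceDeriv j (fun w => f (parabolicScaling z₀ r w))
      = fun w => r⁻¹ * spaceDeriv j f (parabolicScaling z₀ r w) :=
    funext fun w => spaceDeriv_comp_parabolicScaling (hf.differentiable (by simp)) z₀ r w j
  have hd : Differentiable ℝ (fun w => r⁻¹ * spaceDeriv j f w) :=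
    ((contDiff_spaceDeriv hf j).differentiable (by simp)).const_mul _
  rw [h1, spaceDeriv_comp_parabolicScaling (f := fun w => r⁻¹ * spaceDeriv j f w) hd,
    spaceDeriv, fderiv_const_mul ((contDiff_spaceDeriv hf j).differentiable (by simp) _)]
  simp only [smul_apply, smul_eq_mul, spaceDeriv]
  ring

theorem spaceDeriv_sq {f : SpaceTime → ℝ} (hf : Differentiable ℝ f) (z : SpaceTime)
    (j : Fin 3) : spaceDeriv j (fun w => f w ^ 2) z = 2 * f z * spaceDeriv j f z := by
  rw [spaceDeriv, fderiv_fun_pow 2 (hf z)]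
  simp [spaceDeriv]

/-- A smooth cutoff function between `Q_{1/2}(0)` and `Q_1(0)`. -/
def unitCutoff (z : SpaceTime) : ℝ :=
  (⟨1 / 2, 3 / 4, by norm_num, by norm_num⟩ : ContDiffBump (0 : Space)) z.1
    * (⟨1 / 4, 9 / 16, by norm_num, by norm_num⟩ : ContDiffBump (0 : ℝ)) z.2

theorem contDiff_unitCutoff : ContDiff ℝ ∞ unitCutoff :=
  ((ContDiffBump.contDiff _).comp contDiff_fst).mul ((ContDiffBump.contDiff _).comp contDiff_snd)

theorem unitCutoff_nonneg (z : SpaceTime) : 0 ≤ unitCutoff z :=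
  mul_nonneg (ContDiffBump.nonneg _) (ContDiffBump.nonneg _)

theorem unitCutoff_le_one (z : SpaceTime) : unitCutoff z ≤ 1 :=
  mul_le_one₀ (ContDiffBump.le_one _) (ContDiffBump.nonneg _) (ContDiffBump.le_one _)

theorem unitCutoff_eq_one {z : SpaceTime} (h1 : ‖z.1‖ ≤ 1 / 2) (h2 : |z.2| ≤ 1 / 4) :
    unitCutoff z = 1 := by
  rw [unitCutoff, ContDiffBump.one_of_mem_closedBall _ (by simpa using h1),
    ContDiffBump.one_of_mem_closedBall _ (by simpa using h2), one_mul]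

theorem unitCutoff_eq_zero_left {z : SpaceTime} (h : 3 / 4 ≤ ‖z.1‖) : unitCutoff z = 0 := by
  rw [unitCutoff, ContDiffBump.zero_of_le_dist _ (by simpa using h), zero_mul]

theorem unitCutoff_eq_zero_right {z : SpaceTime} (h : 9 / 16 ≤ |z.2|) : unitCutoff z = 0 := by
  rw [unitCutoff, ContDiffBump.zero_of_le_dist (c := (0 : ℝ)) _ (by simpa using h), mul_zero]

theorem hasCompactSupport_unitCutoff : HasCompactSupport unitCutoff := by
  refine HasCompactSupport.of_support_subset_isCompact
    ((isCompact_closedBall (0 : Space) (3 / 4)).prod (isCompact_closedBall (0 : ℝ) (9 / 16)))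
    fun z hz => ⟨?_, ?_⟩
  · by_contra h
    exact hz (unitCutoff_eq_zero_left (by simpa using (not_le.1 (by simpa using h)).le))
  · by_contra h
    exact hz (unitCutoff_eq_zero_right (by simpa using (not_le.1 (by simpa using h)).le))

theorem hasCompactSupport_spaceDeriv {f : SpaceTime → ℝ} (hf : HasCompactSupport f) (j : Fin 3) :
    HasCompactSupport (spaceDeriv j f) :=
  hf.fderiv_apply ℝ _

theorem hasCompactSupport_timeDeriv {f : SpaceTime → ℝ} (hf : HasCompactSupport f) :
    HasCompactSupport (timeDeriv f) :=
  hf.fderiv_apply ℝ _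

theorem exists_norm_le_of_test {f : SpaceTime → ℝ} (hf : ContDiff ℝ ∞ f)
    (hs : HasCompactSupport f) : ∃ C : ℝ, ∀ z, ‖f z‖ ≤ C :=
  hs.exists_bound_of_continuous hf.continuous

/-- All these derivatives are continuous with compact support. Adding their bounds yields one
constant that serves for both estimates. -/
theorem exists_unitCutoff_bound : ∃ L : ℝ, 0 ≤ L ∧ (∀ z j, ‖spaceDeriv j unitCutoff z‖ ≤ L) ∧
    ∀ z, ‖timeDeriv (fun w => unitCutoff w ^ 2) z
      + spaceLaplacian (fun w => unitCutoff w ^ 2) z‖ ≤ L := by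
  have hcd := contDiff_unitCutoff.pow 2
  have hcs : HasCompactSupport fun w => unitCutoff w ^ 2 := by
    simp only [sq]
    exact hasCompactSupport_unitCutoff.mul_right
  choose C hC using fun j => exists_norm_le_of_test (contDiff_spaceDeriv contDiff_unitCutoff j)
    (hasCompactSupport_spaceDeriv hasCompactSupport_unitCutoff j)
  obtain ⟨T, hT⟩ := exists_norm_le_of_test (contDiff_timeDeriv hcd)
    (hasCompactSupport_timeDeriv hcs)
  choose D hD using fun j => exists_norm_le_of_test
    (contDiff_spaceDeriv (contDiff_spaceDeriv hcd j) j)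
    (hasCompactSupport_spaceDeriv (hasCompactSupport_spaceDeriv hcs j) j)
  have hC0 : ∀ j, 0 ≤ C j := fun j => (norm_nonneg _).trans (hC j 0)
  have hD0 : ∀ j, 0 ≤ D j := fun j => (norm_nonneg _).trans (hD j 0)
  have hT0 : 0 ≤ T := (norm_nonneg _).trans (hT 0)
  have hCs : 0 ≤ ∑ j, C j := Finset.sum_nonneg fun j _ => hC0 j
  have hDs : 0 ≤ ∑ j, D j := Finset.sum_nonneg fun j _ => hD0 j
  refine ⟨∑ j, C j + (T + ∑ j, D j), by positivity, fun z j => ?_, fun z => ?_⟩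
  · have := Finset.single_le_sum (fun j _ => hC0 j) (Finset.mem_univ j)
    linarith [hC j z]
  · have h1 : ‖spaceLaplacian (fun w => unitCutoff w ^ 2) z‖ ≤ ∑ j, D j :=
      (norm_sum_le _ _).trans (Finset.sum_le_sum fun j _ => hD j z)
    linarith [norm_add_le (timeDeriv (fun w => unitCutoff w ^ 2) z)
      (spaceLaplacian (fun w => unitCutoff w ^ 2) z), hT z]

/-- Properties of a cutoff function between `Q_{r/2}(z₀)` and `Q_r(z₀)`, with derivative bounds
governed by the constant `L`. -/
structure IsParabolicCutoff (L : ℝ) (z₀ : SpaceTime) (r : ℝ) (ψ : SpaceTime → ℝ) : Prop where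
  contDiff : ContDiff ℝ ∞ ψ
  hasCompactSupport : HasCompactSupport ψ
  nonneg : ∀ z, 0 ≤ ψ z
  le_one : ∀ z, ψ z ≤ 1
  eq_one : ∀ z : SpaceTime, ‖z.1 - z₀.1‖ ≤ r / 2 → |z.2 - z₀.2| ≤ (r / 2) ^ 2 → ψ z = 1
  eq_zero : ∀ᶠ z in 𝓝ˢ (parabolicBoundary (Metric.ball z₀.1 r) (z₀.2 - r ^ 2) z₀.2), ψ z = 0
  isTestFunction_slice : ∀ t, IsTestFunction (Metric.ball z₀.1 r) fun x => ψ (x, t)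
  norm_spaceDeriv_le : ∀ z j, ‖spaceDeriv j ψ z‖ ≤ L / r
  norm_heat_le : ∀ z, ‖timeDeriv (fun w => ψ w ^ 2) z + spaceLaplacian (fun w => ψ w ^ 2) z‖
    ≤ L / r ^ 2

/-- The unit cutoff is rescaled, so `L` is independent of `z₀` and `r`. Its support stays within
`3r/4` in space and `9r²/16` in time, hence away from the bottom and the sides of the cylinder;
nothing is cut off near the top `t = t₀`. -/
theorem exists_isParabolicCutoff : ∃ L : ℝ, 0 ≤ L ∧ ∀ (z₀ : SpaceTime) (r : ℝ), 0 < r →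
    ∃ ψ, IsParabolicCutoff L z₀ r ψ := by
  obtain ⟨L, hL0, hL1, hL2⟩ := exists_unitCutoff_bound
  refine ⟨L, hL0, fun z₀ r hr => ⟨fun z => unitCutoff (parabolicScaling z₀ r z), ?_⟩⟩
  have hcd : ContDiff ℝ ∞ fun z => unitCutoff (parabolicScaling z₀ r z) :=
    contDiff_unitCutoff.comp (contDiff_parabolicScaling z₀ r)
  have hn1 : ∀ z, ‖(parabolicScaling z₀ r z).1‖ = ‖z.1 - z₀.1‖ / r := fun z => by
    rw [parabolicScaling, norm_smul, norm_inv, Real.norm_of_nonneg hr.le, inv_mul_eq_div]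
  have hn2 : ∀ z, |(parabolicScaling z₀ r z).2| = |z.2 - z₀.2| / r ^ 2 := fun z => by
    rw [parabolicScaling, abs_mul, abs_inv, abs_of_nonneg (sq_nonneg r), inv_mul_eq_div]
  have hz1 : ∀ z : SpaceTime, 3 / 4 * r ≤ ‖z.1 - z₀.1‖ →
      unitCutoff (parabolicScaling z₀ r z) = 0 := fun z h =>
    unitCutoff_eq_zero_left (by rw [hn1, le_div_iff₀ hr]; exact h)
  have hz2 : ∀ z : SpaceTime, 9 / 16 * r ^ 2 ≤ |z.2 - z₀.2| →
      unitCutoff (parabolicScaling z₀ r z) = 0 := fun z h =>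
    unitCutoff_eq_zero_right (by rw [hn2, le_div_iff₀ (by positivity)]; exact h)
  have hslice : ∀ t, Function.support (fun x => unitCutoff (parabolicScaling z₀ r (x, t)))
      ⊆ Metric.closedBall z₀.1 (3 / 4 * r) := by
    intro t x hx
    by_contra h
    refine hx (hz1 (x, t) ?_)
    rw [mem_closedBall_iff_norm, not_le] at h
    exact h.le
  refine ⟨hcd, ?_, fun z => unitCutoff_nonneg _, fun z => unitCutoff_le_one _, ?_, ?_, ?_, ?_, ?_⟩
  · refine HasCompactSupport.of_support_subset_isCompact
      ((isCompact_closedBall z₀.1 (3 / 4 * r)).prod (isCompact_closedBall z₀.2 (9 / 16 * r ^ 2)))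
      fun z hz => ⟨hslice z.2 hz, ?_⟩
    by_contra h
    refine hz (hz2 z ?_)
    rw [mem_closedBall_iff_norm, not_le] at h
    exact h.le
  · intro z h1 h2
    refine unitCutoff_eq_one ?_ ?_
    · rw [hn1, div_le_iff₀ hr]; linarith
    · rw [hn2, div_le_iff₀ (by positivity)]; linarith
  · rw [eventually_nhdsSet_iff_forall]
    rintro z (hz | hz)
    · have hz' : z.2 = z₀.2 - r ^ 2 := hz.2
      have : ∀ᶠ w : SpaceTime in 𝓝 z, 9 / 16 * r ^ 2 < |w.2 - z₀.2| := by
        refine (continuous_snd.sub continuous_const).abs.continuousAt.eventually_const_lt ?_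
        change _ < |z.2 - z₀.2|
        rw [hz', sub_sub_cancel_left, abs_neg, abs_of_nonneg (sq_nonneg r)]
        nlinarith
      exact this.mono fun w hw => hz2 w hw.le
    · have hz' : ‖z.1 - z₀.1‖ = r := by
        have := hz.1
        rwa [frontier_ball _ hr.ne', mem_sphere_iff_norm] at this
      have : ∀ᶠ w : SpaceTime in 𝓝 z, 3 / 4 * r < ‖w.1 - z₀.1‖ := by
        refine (continuous_fst.sub continuous_const).norm.continuousAt.eventually_const_lt ?_
        change _ < ‖z.1 - z₀.1‖
        rw [hz']
        linarith
      exact this.mono fun w hw => hz1 w hw.le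
  · intro t
    refine ⟨hcd.comp (contDiff_id.prodMk contDiff_const),
      HasCompactSupport.of_support_subset_isCompact (isCompact_closedBall _ _) (hslice t), ?_⟩
    exact (closure_minimal (hslice t) Metric.isClosed_closedBall).trans
      (Metric.closedBall_subset_ball (by linarith))
  · intro z j
    rw [spaceDeriv_comp_parabolicScaling (contDiff_unitCutoff.differentiable (by simp)), norm_mul,
      norm_inv, Real.norm_of_nonneg hr.le, inv_mul_eq_div]
    gcongr
    exact hL1 _ j
  · intro z
    have h2 := contDiff_unitCutoff.pow 2
    have e1 := timeDeriv_comp_parabolicScaling (h2.differentiable (by simp)) z₀ r z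
    have e2 := spaceLaplacian_comp_parabolicScaling h2 z₀ r z
    rw [e1, e2, ← mul_add, norm_mul, norm_inv, Real.norm_of_nonneg (sq_nonneg r), inv_mul_eq_div]
    gcongr
    exact hL2 _

end Cutoff

/-! ### Mixed norms, interpolation and absorption -/

section Interpolation

section MixedNorm

variable {X T : Type*} [MeasurableSpace X] [MeasurableSpace T]

/-- The mixed norm `‖f‖_{L^β(ν; L^α(μ))}` of a nonnegative function. -/
def mixedNorm (α β : ℝ) (μ : Measure X) (ν : Measure T) (f : X × T → ℝ≥0∞) : ℝ≥0∞ :=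
  (∫⁻ t, (∫⁻ x, f (x, t) ^ α ∂μ) ^ (β / α) ∂ν) ^ (1 / β)

variable {μ : Measure X} {ν : Measure T}

theorem lintegral_le_lintegral_rpow_mul_measure {α : ℝ} (hα : 1 ≤ α) {f : X → ℝ≥0∞}
    (hf : AEMeasurable f μ) :
    ∫⁻ x, f x ∂μ ≤ (∫⁻ x, f x ^ α ∂μ) ^ (1 / α) * μ univ ^ (1 - 1 / α) := by
  have hα0 : 0 < α := by linarith
  have h1 : 1 / α ≤ 1 := by rw [div_le_one hα0]; exact hα
  have h := ENNReal.lintegral_mul_norm_pow_le (μ := μ) (hf.pow_const α)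
    (aemeasurable_const (b := (1 : ℝ≥0∞))) (p := 1 / α) (q := 1 - 1 / α) (by positivity)
    (by linarith) (by ring)
  simp only [ENNReal.one_rpow, mul_one, lintegral_const, one_mul, ← ENNReal.rpow_mul,
    mul_one_div_cancel hα0.ne', ENNReal.rpow_one] at h
  exact h

/-- Hölder's inequality combined with the interpolation of `L^{α'}` between `L²` and `L⁶`. -/
theorem lintegral_mul_le_interpolation {α κ : ℝ} (hα : 0 < α) (hκ0 : 0 ≤ κ) (hκ1 : κ ≤ 1 / 2)
    (hακ : 1 / α = 1 / 2 + 2 * κ / 3) {f v : X → ℝ≥0∞} (hf : AEMeasurable f μ)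
    (hv : AEMeasurable v μ) :
    ∫⁻ x, f x * v x ∂μ ≤ (∫⁻ x, f x ^ α ∂μ) ^ (1 / α) * (∫⁻ x, v x ^ 2 ∂μ) ^ (1 / 2 - κ)
      * (∫⁻ x, v x ^ 6 ∂μ) ^ (κ / 3) := by
  -- Three-factor Hölder with weights `1/α`, `1/2 - κ`, `κ/3`, whose sum is one by `hακ`. The power
  -- of `v` obtained is `2(1/2 - κ) + 6(κ/3) = 1`.
  have h := ENNReal.lintegral_prod_norm_pow_le (μ := μ) Finset.univ
    (f := ![fun x => f x ^ α, fun x => v x ^ 2, fun x => v x ^ 6])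
    (p := ![1 / α, 1 / 2 - κ, κ / 3])
    (by
      intro i _
      fin_cases i
      · exact hf.pow_const α
      · exact hv.pow_const 2
      · exact hv.pow_const 6)
    (by simp only [Fin.sum_univ_three, Matrix.cons_val]; linarith)
    (by
      intro i _
      fin_cases i
      · simpa using hα.le
      · simpa using hκ1
      · exact div_nonneg hκ0 (by norm_num))
  simp only [Fin.prod_univ_three, Matrix.cons_val] at h
  refine le_trans (le_of_eq (lintegral_congr fun x => ?_)) h
  rw [← ENNReal.rpow_mul, mul_one_div_cancel hα.ne', ENNReal.rpow_one, mul_assoc,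
    ← ENNReal.rpow_natCast, ← ENNReal.rpow_natCast, ← ENNReal.rpow_mul, ← ENNReal.rpow_mul,
    ← ENNReal.rpow_add_of_nonneg _ _ (by push_cast; linarith) (by positivity)]
  congr 1
  rw [show ((2 : ℕ) : ℝ) * (1 / 2 - κ) + ((6 : ℕ) : ℝ) * (κ / 3) = 1 by push_cast; ring,
    ENNReal.rpow_one]

variable [SFinite μ] [SFinite ν]

theorem aemeasurable_slice {f : X × T → ℝ≥0∞} (hf : AEMeasurable f (μ.prod ν)) :
    ∀ᵐ t ∂ν, AEMeasurable (fun x => f (x, t)) μ := by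
  filter_upwards [hf.aestronglyMeasurable.prod_swap.prodMk_left] with t ht
  exact ht.aemeasurable

/-- The space-time version: `f ∈ L^β L^α` is paired with `v ∈ L^∞ L² ∩ L² L⁶`. -/
theorem lintegral_prod_mul_le_interpolation {α β κ : ℝ} (hα : 0 < α) (hβ : 0 < β) (hκ0 : 0 ≤ κ)
    (hκ1 : κ ≤ 1 / 2) (hακ : 1 / α = 1 / 2 + 2 * κ / 3) (hβκ : 1 / β = 1 - κ)
    {f v : X × T → ℝ≥0∞} (hf : AEMeasurable f (μ.prod ν)) (hv : AEMeasurable v (μ.prod ν))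
    {H : T → ℝ≥0∞} (hH : AEMeasurable H ν) {E : ℝ≥0∞}
    (hE : ∀ᵐ t ∂ν, ∫⁻ x, v (x, t) ^ 2 ∂μ ≤ E) (hE' : E ≠ ⊤)
    (hS : ∀ᵐ t ∂ν, ∫⁻ x, v (x, t) ^ 6 ∂μ ≤ H t ^ 3) :
    ∫⁻ z, f z * v z ∂(μ.prod ν)
      ≤ mixedNorm α β μ ν f * (E + ∫⁻ t, H t ∂ν) ^ (1 / 2 : ℝ) := by
  have hg : AEMeasurable (fun t => (∫⁻ x, f (x, t) ^ α ∂μ) ^ (β / α)) ν :=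
    (hf.pow_const α).lintegral_prod_left'.pow_const _
  have hκE : E ^ (1 / 2 - κ) ≠ ⊤ := ENNReal.rpow_ne_top_of_nonneg (by linarith) hE'
  rw [lintegral_prod_symm (fun z => f z * v z) (hf.mul hv)]
  calc ∫⁻ t, ∫⁻ x, f (x, t) * v (x, t) ∂μ ∂ν
      ≤ ∫⁻ t, E ^ (1 / 2 - κ) * (((∫⁻ x, f (x, t) ^ α ∂μ) ^ (β / α)) ^ (1 / β) * H t ^ κ) ∂ν := by
        refine lintegral_mono_ae ?_
        filter_upwards [aemeasurable_slice hf, aemeasurable_slice hv, hE, hS]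
          with t hft hvt hEt hSt
        refine (lintegral_mul_le_interpolation hα hκ0 hκ1 hακ hft hvt).trans ?_
        have h1 : (∫⁻ x, v (x, t) ^ 2 ∂μ) ^ (1 / 2 - κ) ≤ E ^ (1 / 2 - κ) :=
          ENNReal.rpow_le_rpow hEt (by linarith)
        have h2 : (∫⁻ x, v (x, t) ^ 6 ∂μ) ^ (κ / 3) ≤ H t ^ κ := by
          refine (ENNReal.rpow_le_rpow hSt (by positivity)).trans (le_of_eq ?_)
          rw [← ENNReal.rpow_natCast, ← ENNReal.rpow_mul]
          congr 1
          push_cast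
          ring
        rw [← ENNReal.rpow_mul, show β / α * (1 / β) = 1 / α by field_simp]
        calc _ ≤ (∫⁻ x, f (x, t) ^ α ∂μ) ^ (1 / α) * E ^ (1 / 2 - κ) * H t ^ κ := by gcongr
          _ = _ := by ring
    _ = E ^ (1 / 2 - κ) * ∫⁻ t, ((∫⁻ x, f (x, t) ^ α ∂μ) ^ (β / α)) ^ (1 / β) * H t ^ κ ∂ν :=
        lintegral_const_mul' _ _ hκE
    -- Hölder in time with weights `1/β` and `κ`, which add up to one by `hβκ`.
    _ ≤ E ^ (1 / 2 - κ) * (mixedNorm α β μ ν f * (∫⁻ t, H t ∂ν) ^ κ) := by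
        gcongr
        exact ENNReal.lintegral_mul_norm_pow_le hg hH (by positivity) hκ0 (by linarith)
    -- Enlarging both bases to the total energy merges the powers `1/2 - κ` and `κ` into `1/2`,
    -- whatever `κ` is.
    _ ≤ (E + ∫⁻ t, H t ∂ν) ^ (1 / 2 - κ)
          * (mixedNorm α β μ ν f * (E + ∫⁻ t, H t ∂ν) ^ κ) := by
        gcongr
        · exact le_self_add
        · exact le_add_self
    _ = _ := by
        rw [mul_left_comm, ← ENNReal.rpow_add_of_nonneg _ _ (by linarith) hκ0, sub_add_cancel]

/-- Hölder against the constant 1, in space and then in time. It controls the lower-order term `∫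
|u|²`. -/
theorem lintegral_prod_le_mixedNorm {α β : ℝ} (hα : 1 ≤ α) (hβ : 1 ≤ β) [IsFiniteMeasure μ]
    {f : X × T → ℝ≥0∞} (hf : AEMeasurable f (μ.prod ν)) :
    ∫⁻ z, f z ∂(μ.prod ν)
      ≤ mixedNorm α β μ ν f * (μ univ ^ (1 - 1 / α) * ν univ ^ (1 - 1 / β)) := by
  have hα0 : 0 < α := by linarith
  have hβ0 : 0 < β := by linarith
  have hG : AEMeasurable (fun t => ∫⁻ x, f (x, t) ^ α ∂μ) ν :=
    (hf.pow_const α).lintegral_prod_left'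
  have h1 : 1 / α ≤ 1 := by rw [div_le_one hα0]; exact hα
  rw [lintegral_prod_symm _ hf]
  calc ∫⁻ t, ∫⁻ x, f (x, t) ∂μ ∂ν
      ≤ ∫⁻ t, (∫⁻ x, f (x, t) ^ α ∂μ) ^ (1 / α) * μ univ ^ (1 - 1 / α) ∂ν := by
        refine lintegral_mono_ae ?_
        filter_upwards [aemeasurable_slice hf] with t ht
        exact lintegral_le_lintegral_rpow_mul_measure hα ht
    _ = (∫⁻ t, (∫⁻ x, f (x, t) ^ α ∂μ) ^ (1 / α) ∂ν) * μ univ ^ (1 - 1 / α) :=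
        lintegral_mul_const' _ _
          (ENNReal.rpow_ne_top_of_nonneg (by linarith) (measure_ne_top μ univ))
    _ ≤ ((∫⁻ t, ((∫⁻ x, f (x, t) ^ α ∂μ) ^ (1 / α)) ^ β ∂ν) ^ (1 / β)
          * ν univ ^ (1 - 1 / β)) * μ univ ^ (1 - 1 / α) := by
        gcongr
        exact lintegral_le_lintegral_rpow_mul_measure hβ (hG.pow_const _)
    _ = _ := by
        simp only [← ENNReal.rpow_mul, one_div_mul_eq_div]
        rw [mixedNorm]
        ring

end MixedNorm

/-- If `W ≤ P + B √W` with `W` finite, then `W ≤ 2 P + 4 B²`. -/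
theorem le_of_le_add_mul_sqrt {W P B : ℝ≥0∞} (hW : W ≠ ⊤)
    (h : W ≤ P + B * W ^ (1 / 2 : ℝ)) : W ≤ 2 * P + 4 * B ^ 2 := by
  by_cases hP : P = ⊤
  · simp [hP]
  by_cases hB : B = ⊤
  · simp [hB]
  lift W to ℝ≥0 using hW
  lift P to ℝ≥0 using hP
  lift B to ℝ≥0 using hB
  rw [← ENNReal.coe_rpow_of_nonneg _ (by norm_num)] at h
  norm_cast at h ⊢
  rw [← NNReal.sqrt_eq_rpow] at h
  have h1 := NNReal.sq_sqrt W
  rw [← NNReal.coe_le_coe] at h ⊢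
  have h2 : ((NNReal.sqrt W : ℝ≥0) : ℝ) ^ 2 = W := by exact_mod_cast h1
  push_cast at h ⊢
  have hP0 := P.coe_nonneg
  simp only [Real.coe_sqrt] at h2
  -- Young's inequality `B√W ≤ (W + B²)/2` gives even `W ≤ 2P + B²`.
  nlinarith [sq_nonneg (√(W : ℝ) - B), sq_nonneg (B : ℝ)]

/-- A bound for the integrals over `s × (a, t)`, for almost every `t < b`, holds for `t = b`. -/
theorem setLIntegral_prod_Ioo_le_of_ae {X : Type*} [MeasurableSpace X] {m : Measure (X × ℝ)}
    {s : Set X} {a b : ℝ} (hab : a < b) {g : X × ℝ → ℝ≥0∞} {K : ℝ≥0∞}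
    (h : ∀ᵐ t ∂(volume.restrict (Ioo a b)), ∫⁻ z in s ×ˢ Ioo a t, g z ∂m ≤ K) :
    ∫⁻ z in s ×ˢ Ioo a b, g z ∂m ≤ K := by
  have h1 : ∀ t ∈ Ioo a b, ∫⁻ z in s ×ˢ Ioo a t, g z ∂m ≤ K := by
    intro t ht
    -- The integral increases with the endpoint, so a good time `t'` after `t` yields the bound at
    -- every `t`; monotone convergence then reaches `b`.
    have h2 : ∀ᵐ t' ∂(volume.restrict (Ioo t b)), ∫⁻ z in s ×ˢ Ioo a t', g z ∂m ≤ K :=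
      ae_restrict_of_ae_restrict_of_subset (Ioo_subset_Ioo_left ht.1.le) h
    have h3 : ∀ᵐ t' ∂(volume.restrict (Ioo t b)), t' ∈ Ioo t b :=
      ae_restrict_mem measurableSet_Ioo
    have : (ae (volume.restrict (Ioo t b))).NeBot := by
      rw [ae_neBot, Ne, Measure.restrict_eq_zero]
      simpa using ht.2
    obtain ⟨t', h4, h5⟩ := (h2.and h3).exists
    exact (lintegral_mono_set (prod_mono_right (Ioo_subset_Ioo_right h5.1.le))).trans h4
  obtain ⟨w, hw1, hw2, hw3⟩ := exists_seq_strictMono_tendsto' hab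
  have hU : s ×ˢ Ioo a b = ⋃ n, s ×ˢ Ioo a (w n) := by
    ext z
    simp only [mem_iUnion, mem_prod, mem_Ioo]
    constructor
    · rintro ⟨hz1, hz2, hz3⟩
      obtain ⟨n, hn⟩ := (hw3.eventually_const_lt hz3).exists
      exact ⟨n, hz1, hz2, hn⟩
    · rintro ⟨n, hz1, hz2, hz3⟩
      exact ⟨hz1, hz2, hz3.trans (hw2 n).2⟩
  have hmono : Monotone fun n => s ×ˢ Ioo a (w n) := fun n k hnk =>
    prod_mono_right (Ioo_subset_Ioo_right (hw1.monotone hnk))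
  rw [hU, setLIntegral_iUnion_of_directed _ hmono.directed_le]
  exact iSup_le fun n => h1 _ (hw2 n)

end Interpolation

/-! ### Regularity of time slices and the local energy inequality -/

section LocalEnergy

theorem volume_restrict_prod (Ω : Set Space) (I : Set ℝ) :
    (volume : Measure SpaceTime).restrict (Ω ×ˢ I)
      = (volume.restrict Ω).prod (volume.restrict I) := by
  rw [Measure.volume_eq_prod, Measure.prod_restrict]

theorem IsSuitableWeakSolution.ae_memLp_slice {u : SpaceTime → Space}
    {Du : SpaceTime → Fin 3 → Fin 3 → ℝ} {p : SpaceTime → ℝ} {Ω : Set Space} {a b : ℝ}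
    (h : IsSuitableWeakSolution u Du p Ω a b) :
    ∀ᵐ t ∂(volume.restrict (Ioo a b)), MemLp (fun x => u (x, t)) 2 (volume.restrict Ω) := by
  obtain ⟨M, hM⟩ := h.energy_bound
  have hm := h.measurable_u
  rw [volume_restrict_prod] at hm
  filter_upwards [hM, hm.prodMk_right] with t h1 h2
  exact ⟨h2, h1.trans_lt ENNReal.coe_lt_top⟩

theorem IsSuitableWeakSolution.ae_memLp_gradient_slice {u : SpaceTime → Space}
    {Du : SpaceTime → Fin 3 → Fin 3 → ℝ} {p : SpaceTime → ℝ} {Ω : Set Space} {a b : ℝ}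
    (h : IsSuitableWeakSolution u Du p Ω a b) :
    ∀ᵐ t ∂(volume.restrict (Ioo a b)), ∀ i j,
      MemLp (fun x => Du (x, t) i j) 2 (volume.restrict Ω) := by
  refine ae_all_iff.2 fun i => ae_all_iff.2 fun j => ?_
  have hm := h.memLp_Du i j
  rw [volume_restrict_prod] at hm
  have hi := (memLp_two_iff_integrable_sq hm.1).1 hm
  filter_upwards [hm.1.prodMk_right, hi.prod_left_ae] with t h1 h2
  exact (memLp_two_iff_integrable_sq h1).2 h2

theorem IsSuitableWeakSolution.integrable_frobSq {u : SpaceTime → Space}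
    {Du : SpaceTime → Fin 3 → Fin 3 → ℝ} {p : SpaceTime → ℝ} {Ω : Set Space} {a b : ℝ}
    (h : IsSuitableWeakSolution u Du p Ω a b) :
    IntegrableOn (fun z => frobSq (Du z)) (Ω ×ˢ Ioo a b) volume :=
  integrable_finsetSum _ fun i _ => integrable_finsetSum _ fun j _ =>
    (h.memLp_Du i j).integrable_sq

theorem frobSq_nonneg (M : Fin 3 → Fin 3 → ℝ) : 0 ≤ frobSq M :=
  Finset.sum_nonneg fun _ _ => Finset.sum_nonneg fun _ _ => sq_nonneg _

variable {u : SpaceTime → Space} {Du : SpaceTime → Fin 3 → Fin 3 → ℝ} {p : SpaceTime → ℝ}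
  {z₀ : SpaceTime} {r L : ℝ} {ψ : SpaceTime → ℝ}

theorem IsParabolicCutoff.enorm_le_one (hψ : IsParabolicCutoff L z₀ r ψ) (z : SpaceTime) :
    ‖ψ z‖ₑ ≤ 1 := by
  rw [Real.enorm_eq_ofReal (hψ.nonneg z)]
  exact ENNReal.ofReal_le_one.2 (hψ.le_one z)

/-- By `∇(ψ²) = 2ψ∇ψ`, one factor `ψ` survives and is attached to `v`, as the later absorption
needs. The 6 is 2 times the three components. -/
theorem IsParabolicCutoff.enorm_flux_le (hψ : IsParabolicCutoff L z₀ r ψ) (hL : 0 ≤ L)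
    (hr : 0 < r) (z : SpaceTime) (v : Space) (q : ℝ) :
    ‖(‖v‖ ^ 2 + 2 * q) * ∑ j, v j * spaceDeriv j (fun w => ψ w ^ 2) z‖ₑ
      ≤ ENNReal.ofReal (6 * L / r)
        * ((‖v‖ₑ ^ 2 + 2 * ‖q‖ₑ) * (‖ψ z‖ₑ * ‖v‖ₑ)) := by
  have h1 : ‖∑ j, v j * spaceDeriv j (fun w => ψ w ^ 2) z‖ ≤ 6 * L / r * (‖ψ z‖ * ‖v‖) := by
    calc _ ≤ ∑ j : Fin 3, ‖v j * spaceDeriv j (fun w => ψ w ^ 2) z‖ := norm_sum_le _ _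
      _ ≤ ∑ _j : Fin 3, 2 * L / r * (‖ψ z‖ * ‖v‖) := by
        gcongr with j
        rw [spaceDeriv_sq (hψ.contDiff.differentiable (by simp)), norm_mul, norm_mul, norm_mul,
          Real.norm_ofNat]
        calc ‖v j‖ * (2 * ‖ψ z‖ * ‖spaceDeriv j ψ z‖) ≤ ‖v‖ * (2 * ‖ψ z‖ * (L / r)) := by
              gcongr
              · exact PiLp.norm_apply_le v j
              · exact hψ.norm_spaceDeriv_le z j
          _ = _ := by ring
      _ = _ := by simp; ring
  have h2 : ‖‖v‖ ^ 2 + 2 * q‖ ≤ ‖v‖ ^ 2 + 2 * ‖q‖ := by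
    refine (norm_add_le _ _).trans (le_of_eq ?_)
    simp
  have h3 : ‖(‖v‖ ^ 2 + 2 * q) * ∑ j, v j * spaceDeriv j (fun w => ψ w ^ 2) z‖
      ≤ 6 * L / r * ((‖v‖ ^ 2 + 2 * ‖q‖) * (‖ψ z‖ * ‖v‖)) := by
    rw [norm_mul]
    calc _ ≤ (‖v‖ ^ 2 + 2 * ‖q‖) * (6 * L / r * (‖ψ z‖ * ‖v‖)) := by gcongr
      _ = _ := by ring
  have h4 := ENNReal.ofReal_le_ofReal h3
  rw [ENNReal.ofReal_mul (by positivity), ENNReal.ofReal_mul (by positivity),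
    ENNReal.ofReal_mul (by positivity), ENNReal.ofReal_add (by positivity) (by positivity),
    ENNReal.ofReal_mul (by positivity), ENNReal.ofReal_pow (by positivity)] at h4
  simpa only [ofReal_norm, ENNReal.ofReal_ofNat] using h4

/-- The local energy inequality, written with extended nonnegative integrals. -/
theorem IsSuitableWeakSolution.ae_local_energy_le
    (h : IsSuitableWeakSolution u Du p (Metric.ball z₀.1 r) (z₀.2 - r ^ 2) z₀.2)
    (hψ : IsParabolicCutoff L z₀ r ψ) (hL : 0 ≤ L) (hr : 0 < r) :
    ∀ᵐ t ∂(volume.restrict (Ioo (z₀.2 - r ^ 2) z₀.2)),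
      (∫⁻ x in Metric.ball z₀.1 r, (‖ψ (x, t)‖ₑ * ‖u (x, t)‖ₑ) ^ 2)
        + 2 * ∫⁻ z in Metric.ball z₀.1 r ×ˢ Ioo (z₀.2 - r ^ 2) t,
            ‖ψ z‖ₑ ^ 2 * ENNReal.ofReal (frobSq (Du z))
      ≤ ENNReal.ofReal (L / r ^ 2)
          * (∫⁻ z in Metric.ball z₀.1 r ×ˢ Ioo (z₀.2 - r ^ 2) z₀.2, ‖u z‖ₑ ^ 2)
        + ENNReal.ofReal (6 * L / r)
          * ∫⁻ z in Metric.ball z₀.1 r ×ˢ Ioo (z₀.2 - r ^ 2) z₀.2,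
              (‖u z‖ₑ ^ 2 + 2 * ‖p z‖ₑ) * (‖ψ z‖ₑ * ‖u z‖ₑ) := by
  filter_upwards [h.energy_inequality, h.ae_memLp_slice, ae_restrict_mem measurableSet_Ioo]
    with t ht hut htI
  have hψc : Continuous ψ := hψ.contDiff.continuous
  have hφ0 : ∀ z, ‖ψ z ^ 2‖ ≤ 1 := fun z => by
    rw [norm_pow, Real.norm_of_nonneg (hψ.nonneg z)]
    exact pow_le_one₀ (hψ.nonneg z) (hψ.le_one z)
  have hsub : Metric.ball z₀.1 r ×ˢ Ioo (z₀.2 - r ^ 2) t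
      ⊆ Metric.ball z₀.1 r ×ˢ Ioo (z₀.2 - r ^ 2) z₀.2 :=
    prod_mono_right (Ioo_subset_Ioo_right htI.2.le)
  have key := ht (fun z => ψ z ^ 2) (hψ.contDiff.pow 2)
    (by simp only [sq]; exact hψ.hasCompactSupport.mul_right) (fun z => sq_nonneg _)
    (hψ.eq_zero.mono fun z hz => by simp [hz])
  have e1 : ENNReal.ofReal (∫ x in Metric.ball z₀.1 r, ‖u (x, t)‖ ^ 2 * ψ (x, t) ^ 2)
      = ∫⁻ x in Metric.ball z₀.1 r, (‖ψ (x, t)‖ₑ * ‖u (x, t)‖ₑ) ^ 2 := by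
    rw [ofReal_integral_eq_lintegral_ofReal _ (Eventually.of_forall fun x => by positivity)]
    · refine lintegral_congr fun x => ?_
      rw [ENNReal.ofReal_mul (by positivity), ENNReal.ofReal_pow (by positivity),
        ENNReal.ofReal_pow (hψ.nonneg _), ofReal_norm, Real.enorm_eq_ofReal (hψ.nonneg _)]
      ring
    · exact (hut.integrable_norm_pow (by norm_num)).mul_bdd (c := 1)
        ((hψc.comp (Continuous.prodMk_left t)).pow 2).aestronglyMeasurable
        (Eventually.of_forall fun x => hφ0 (x, t))
  have e2 : ENNReal.ofReal (∫ z in Metric.ball z₀.1 r ×ˢ Ioo (z₀.2 - r ^ 2) t,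
        frobSq (Du z) * ψ z ^ 2)
      = ∫⁻ z in Metric.ball z₀.1 r ×ˢ Ioo (z₀.2 - r ^ 2) t,
            ‖ψ z‖ₑ ^ 2 * ENNReal.ofReal (frobSq (Du z)) := by
    rw [ofReal_integral_eq_lintegral_ofReal _
      (Eventually.of_forall fun z => mul_nonneg (frobSq_nonneg _) (sq_nonneg _))]
    · refine lintegral_congr fun x => ?_
      rw [ENNReal.ofReal_mul (frobSq_nonneg _),
        ENNReal.ofReal_pow (hψ.nonneg _), Real.enorm_eq_ofReal (hψ.nonneg _)]
      ring
    · exact (h.integrable_frobSq.mono_set hsub).mul_bdd (c := 1)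
        (hψc.pow 2).aestronglyMeasurable (Eventually.of_forall hφ0)
  -- Terms on the right have no sign: absolute values are taken and the time interval is enlarged,
  -- making the bound independent of `t`.
  have e3 : ∀ (f : SpaceTime → ℝ) (g : SpaceTime → ℝ≥0∞) (c : ℝ), (∀ z, ‖f z‖ₑ ≤
      ENNReal.ofReal c * g z) →
      ENNReal.ofReal (∫ z in Metric.ball z₀.1 r ×ˢ Ioo (z₀.2 - r ^ 2) t, f z)
      ≤ ENNReal.ofReal c * ∫⁻ z in Metric.ball z₀.1 r ×ˢ Ioo (z₀.2 - r ^ 2) z₀.2, g z := by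
    intro f g c hfg
    calc _ ≤ ‖∫ z in Metric.ball z₀.1 r ×ˢ Ioo (z₀.2 - r ^ 2) t, f z‖ₑ := by
          rw [← ofReal_norm]
          exact ENNReal.ofReal_le_ofReal (Real.le_norm_self _)
      _ ≤ ∫⁻ z in Metric.ball z₀.1 r ×ˢ Ioo (z₀.2 - r ^ 2) t, ‖f z‖ₑ :=
          enorm_integral_le_lintegral_enorm _
      _ ≤ ∫⁻ z in Metric.ball z₀.1 r ×ˢ Ioo (z₀.2 - r ^ 2) z₀.2, ENNReal.ofReal c * g z :=
          (lintegral_mono hfg).trans (lintegral_mono_set hsub)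
      _ = _ := lintegral_const_mul' _ _ ENNReal.ofReal_ne_top
  have e4 := e3 (fun z => ‖u z‖ ^ 2 * (timeDeriv (fun w => ψ w ^ 2) z
    + spaceLaplacian (fun w => ψ w ^ 2) z)) (fun z => ‖u z‖ₑ ^ 2) (L / r ^ 2) (by
      intro z
      rw [enorm_mul, mul_comm, enorm_pow, enorm_norm]
      gcongr
      rw [← ofReal_norm]
      exact ENNReal.ofReal_le_ofReal (hψ.norm_heat_le z))
  have e5 := e3 (fun z => (‖u z‖ ^ 2 + 2 * p z) * ∑ j, u z j * spaceDeriv j (fun w => ψ w ^ 2) z)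
    (fun z => (‖u z‖ₑ ^ 2 + 2 * ‖p z‖ₑ) * (‖ψ z‖ₑ * ‖u z‖ₑ)) (6 * L / r)
    (fun z => hψ.enorm_flux_le hL hr z (u z) (p z))
  have h6 := ENNReal.ofReal_le_ofReal key
  rw [ENNReal.ofReal_add (integral_nonneg fun x => by positivity)
    (mul_nonneg (by norm_num) (integral_nonneg fun z =>
      mul_nonneg (frobSq_nonneg _) (sq_nonneg _))), ENNReal.ofReal_mul (by norm_num), e1, e2,
    ENNReal.ofReal_ofNat] at h6
  exact h6.trans (ENNReal.ofReal_add_le.trans (add_le_add e4 e5))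

end LocalEnergy

/-! ### Energy of the localized velocity in terms of mixed norms -/

section EnergyBound

variable {u : SpaceTime → Space} {Du : SpaceTime → Fin 3 → Fin 3 → ℝ} {p : SpaceTime → ℝ}
  {z₀ : SpaceTime} {r L : ℝ} {ψ : SpaceTime → ℝ}

/-- The energy of `ψ u` in `Q_r(z₀)`. -/
def cutoffEnergy (u : SpaceTime → Space) (Du : SpaceTime → Fin 3 → Fin 3 → ℝ)
    (ψ : SpaceTime → ℝ) (z₀ : SpaceTime) (r : ℝ) : ℝ≥0∞ :=
  essSup (fun t => ∫⁻ x in Metric.ball z₀.1 r, (‖ψ (x, t)‖ₑ * ‖u (x, t)‖ₑ) ^ 2)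
      (volume.restrict (Ioo (z₀.2 - r ^ 2) z₀.2))
    + 2 * ∫⁻ z in Metric.ball z₀.1 r ×ˢ Ioo (z₀.2 - r ^ 2) z₀.2,
        ‖ψ z‖ₑ ^ 2 * ENNReal.ofReal (frobSq (Du z))

/-- Qualitative finiteness, with no control on its size, is what permits absorbing the energy on the
right. -/
theorem IsSuitableWeakSolution.essSup_cutoff_ne_top
    (h : IsSuitableWeakSolution u Du p (Metric.ball z₀.1 r) (z₀.2 - r ^ 2) z₀.2)
    (hψ : IsParabolicCutoff L z₀ r ψ) :
    essSup (fun t => ∫⁻ x in Metric.ball z₀.1 r, (‖ψ (x, t)‖ₑ * ‖u (x, t)‖ₑ) ^ 2)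
      (volume.restrict (Ioo (z₀.2 - r ^ 2) z₀.2)) ≠ ⊤ := by
  obtain ⟨M, hM⟩ := h.energy_bound
  refine ne_top_of_le_ne_top (b := (M : ℝ≥0∞) ^ 2) (by simp) (essSup_le_of_ae_le _ ?_)
  filter_upwards [hM] with t ht
  calc ∫⁻ x in Metric.ball z₀.1 r, (‖ψ (x, t)‖ₑ * ‖u (x, t)‖ₑ) ^ 2
      ≤ ∫⁻ x in Metric.ball z₀.1 r, ‖u (x, t)‖ₑ ^ 2 := by
        gcongr with x
        exact mul_le_of_le_one_left' (hψ.enorm_le_one _)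
    _ = eLpNorm (fun x => u (x, t)) 2 (volume.restrict (Metric.ball z₀.1 r)) ^ 2 := by
        rw [eLpNorm_eq_lintegral_rpow_enorm_toReal (by norm_num) (by norm_num),
          ← ENNReal.rpow_natCast, ← ENNReal.rpow_mul]
        norm_num
    _ ≤ _ := pow_le_pow_left' ht 2

theorem IsSuitableWeakSolution.lintegral_cutoff_frobSq_ne_top
    (h : IsSuitableWeakSolution u Du p (Metric.ball z₀.1 r) (z₀.2 - r ^ 2) z₀.2)
    (hψ : IsParabolicCutoff L z₀ r ψ) :
    ∫⁻ z in Metric.ball z₀.1 r ×ˢ Ioo (z₀.2 - r ^ 2) z₀.2,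
        ‖ψ z‖ₑ ^ 2 * ENNReal.ofReal (frobSq (Du z)) ≠ ⊤ := by
  refine ne_top_of_le_ne_top h.integrable_frobSq.lintegral_lt_top.ne ?_
  gcongr with z
  exact mul_le_of_le_one_left' (pow_le_one₀ (by simp) (hψ.enorm_le_one _))

theorem IsSuitableWeakSolution.lintegral_sq_ne_top {Ω : Set Space} {a b : ℝ}
    (h : IsSuitableWeakSolution u Du p Ω a b) :
    ∫⁻ z in Ω ×ˢ Ioo a b, ‖u z‖ₑ ^ 2 ≠ ⊤ := by
  have h1 := lintegral_rpow_enorm_lt_top_of_eLpNorm_lt_top (by norm_num) (by norm_num)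
    h.memLp_u.2
  simpa using h1.ne

theorem IsSuitableWeakSolution.cutoffEnergy_le_flux
    (h : IsSuitableWeakSolution u Du p (Metric.ball z₀.1 r) (z₀.2 - r ^ 2) z₀.2)
    (hψ : IsParabolicCutoff L z₀ r ψ) (hL : 0 ≤ L) (hr : 0 < r) :
    cutoffEnergy u Du ψ z₀ r ≤ 2 * (ENNReal.ofReal (L / r ^ 2)
          * (∫⁻ z in Metric.ball z₀.1 r ×ˢ Ioo (z₀.2 - r ^ 2) z₀.2, ‖u z‖ₑ ^ 2)
        + ENNReal.ofReal (6 * L / r)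
          * ∫⁻ z in Metric.ball z₀.1 r ×ˢ Ioo (z₀.2 - r ^ 2) z₀.2,
              (‖u z‖ₑ ^ 2 + 2 * ‖p z‖ₑ) * (‖ψ z‖ₑ * ‖u z‖ₑ)) := by
  have key := h.ae_local_energy_le hψ hL hr
  -- One copy of the right side bounds the supremum, the other the gradient term.
  rw [cutoffEnergy, two_mul (_ + _)]
  refine add_le_add (essSup_le_of_ae_le _ (key.mono fun t ht => le_self_add.trans ht)) ?_
  have h1 := setLIntegral_prod_Ioo_le_of_ae (m := volume) h.lt
    (g := fun z => 2 * (‖ψ z‖ₑ ^ 2 * ENNReal.ofReal (frobSq (Du z))))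
    (key.mono fun t ht => by
      rw [lintegral_const_mul' _ _ (by simp)]
      exact le_add_self.trans ht)
  rwa [lintegral_const_mul' _ _ (by simp)] at h1

/-- The energy of `ψ u` is controlled by the mixed norms of `|u|²` and `p`. -/
theorem exists_cutoffEnergy_le : ∃ K : ℝ≥0, ∀ (α β κ : ℝ), 0 < α → 0 < β → 0 ≤ κ → κ ≤ 1 / 2 →
    1 / α = 1 / 2 + 2 * κ / 3 → 1 / β = 1 - κ → ∀ (z₀ : SpaceTime) (r L : ℝ), 0 < r → 0 ≤ L →
    ∀ (u : SpaceTime → Space) (Du : SpaceTime → Fin 3 → Fin 3 → ℝ) (p ψ : SpaceTime → ℝ),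
    IsSuitableWeakSolution u Du p (Metric.ball z₀.1 r) (z₀.2 - r ^ 2) z₀.2 →
    IsParabolicCutoff L z₀ r ψ →
    cutoffEnergy u Du ψ z₀ r ≤
      2 * ((2 * ENNReal.ofReal (L / r ^ 2) + ENNReal.ofReal (L / r) ^ 2)
        * ∫⁻ z in Metric.ball z₀.1 r ×ˢ Ioo (z₀.2 - r ^ 2) z₀.2, ‖u z‖ₑ ^ 2)
      + K * (ENNReal.ofReal (6 * L / r) *
          (mixedNorm α β (volume.restrict (Metric.ball z₀.1 r))
            (volume.restrict (Ioo (z₀.2 - r ^ 2) z₀.2)) (fun z => ‖u z‖ₑ ^ 2)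
          + 2 * mixedNorm α β (volume.restrict (Metric.ball z₀.1 r))
            (volume.restrict (Ioo (z₀.2 - r ^ 2) z₀.2)) (fun z => ‖p z‖ₑ))) ^ 2 := by
  obtain ⟨K, hK⟩ := exists_lintegral_vector_pow_six_le
  -- `4B²` with `B = 2 l₁ (N + 2N') (K + 1)^{1/2}`.
  refine ⟨16 * (K + 1), fun α β κ hα hβ hκ0 hκ1 hακ hβκ z₀ r L hr hL u Du p ψ h hψ => ?_⟩
  have hEtop := h.essSup_cutoff_ne_top hψ
  have hFtop := h.lintegral_cutoff_frobSq_ne_top hψ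
  have hUtop := h.lintegral_sq_ne_top
  have hflux := h.cutoffEnergy_le_flux hψ hL hr
  have hum : AEMeasurable (fun z => ‖u z‖ₑ) ((volume.restrict (Metric.ball z₀.1 r)).prod
      (volume.restrict (Ioo (z₀.2 - r ^ 2) z₀.2))) := by
    have := h.measurable_u.enorm
    rwa [volume_restrict_prod] at this
  have hpm : AEMeasurable (fun z => ‖p z‖ₑ) ((volume.restrict (Metric.ball z₀.1 r)).prod
      (volume.restrict (Ioo (z₀.2 - r ^ 2) z₀.2))) := by
    have := h.memLp_p.1.enorm
    rwa [volume_restrict_prod] at this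
  have hψm : Measurable fun z => ‖ψ z‖ₑ := hψ.contDiff.continuous.enorm.measurable
  have hDum : AEMeasurable (fun z => ‖ψ z‖ₑ ^ 2 * ENNReal.ofReal (frobSq (Du z)))
      ((volume.restrict (Metric.ball z₀.1 r)).prod
      (volume.restrict (Ioo (z₀.2 - r ^ 2) z₀.2))) := by
    have := h.integrable_frobSq.1.aemeasurable.ennreal_ofReal
    rw [volume_restrict_prod] at this
    exact (hψm.pow_const 2).aemeasurable.mul this
  rw [cutoffEnergy] at hflux ⊢
  rw [volume_restrict_prod] at hflux hFtop hUtop ⊢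
  set μ := (volume : Measure Space).restrict (Metric.ball z₀.1 r) with hμ
  set ν := (volume : Measure ℝ).restrict (Ioo (z₀.2 - r ^ 2) z₀.2) with hν
  set E := essSup (fun t => ∫⁻ x, (‖ψ (x, t)‖ₑ * ‖u (x, t)‖ₑ) ^ 2 ∂μ) ν with hE
  set F := ∫⁻ z, ‖ψ z‖ₑ ^ 2 * ENNReal.ofReal (frobSq (Du z)) ∂(μ.prod ν) with hF
  set U := ∫⁻ z, ‖u z‖ₑ ^ 2 ∂(μ.prod ν) with hU
  set N := mixedNorm α β μ ν fun z => ‖u z‖ₑ ^ 2 with hN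
  set N' := mixedNorm α β μ ν fun z => ‖p z‖ₑ with hN'
  set l := ENNReal.ofReal (L / r) with hl
  -- Including `l² U` makes `W` dominate the full right side of the Sobolev inequality for `ψu`,
  -- with the term from `∇ψ`.
  set W := E + 2 * F + l ^ 2 * U with hW
  have hWtop : W ≠ ⊤ := by
    simp only [hW, hl]
    finiteness
  have hm1 : AEMeasurable (fun t => ∫⁻ x, ‖ψ (x, t)‖ₑ ^ 2 * ENNReal.ofReal (frobSq (Du (x, t))) ∂μ)
      ν := hDum.lintegral_prod_left'
  have hm2 : AEMeasurable (fun t => ∫⁻ x, ‖u (x, t)‖ₑ ^ 2 ∂μ) ν :=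
    (hum.pow_const 2).lintegral_prod_left'
  set H : ℝ → ℝ≥0∞ := fun t => K * ((∫⁻ x, ‖ψ (x, t)‖ₑ ^ 2 * ENNReal.ofReal (frobSq (Du (x, t))) ∂μ)
    + l ^ 2 * ∫⁻ x, ‖u (x, t)‖ₑ ^ 2 ∂μ) with hH
  have hHm : AEMeasurable H ν := (hm1.add (hm2.const_mul _)).const_mul _
  have hHint : ∫⁻ t, H t ∂ν = K * (F + l ^ 2 * U) := by
    rw [hH, lintegral_const_mul' _ _ (by simp), lintegral_add_left' hm1,
      lintegral_const_mul' _ _ (by simp [hl]), hF, hU, lintegral_prod_symm _ hDum,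
      lintegral_prod_symm _ (hum.pow_const 2)]
  have hS : ∀ᵐ t ∂ν, ∫⁻ x, (‖ψ (x, t)‖ₑ * ‖u (x, t)‖ₑ) ^ 6 ∂μ ≤ H t ^ 3 := by
    filter_upwards [h.ae_memLp_slice, h.ae_memLp_gradient_slice, h.weak_gradient] with t h1 h2 h3
    refine hK _ h.isOpen_domain _ (fun x => Du (x, t)) h1 h2 h3 _ (hψ.isTestFunction_slice t)
      (L / r).toNNReal fun x j => ?_
    rw [fderiv_slice (hψ.contDiff.differentiable (by simp)), ← ofReal_norm]
    exact ENNReal.ofReal_le_ofReal (hψ.norm_spaceDeriv_le _ j)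
  have hE2 : ∀ᵐ t ∂ν, ∫⁻ x, (‖ψ (x, t)‖ₑ * ‖u (x, t)‖ₑ) ^ 2 ∂μ ≤ E := ae_le_essSup
  have hvm : AEMeasurable (fun z => ‖ψ z‖ₑ * ‖u z‖ₑ) (μ.prod ν) := hψm.aemeasurable.mul hum
  have hEH : E + ∫⁻ t, H t ∂ν ≤ (K + 1) * W := by
    rw [hHint, hW]
    calc E + K * (F + l ^ 2 * U) ≤ (K + 1) * E + ((K + 1) * (2 * F) + (K + 1) * (l ^ 2 * U)) := by
          rw [mul_add (K : ℝ≥0∞)]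
          gcongr
          · exact le_mul_of_one_le_left' le_add_self
          · exact le_self_add
          · exact le_mul_of_one_le_left' (by norm_num)
          · exact le_self_add
      _ = _ := by ring
  have hI : ∀ f : SpaceTime → ℝ≥0∞, AEMeasurable f (μ.prod ν) →
      ∫⁻ z, f z * (‖ψ z‖ₑ * ‖u z‖ₑ) ∂(μ.prod ν)
        ≤ mixedNorm α β μ ν f * ((K + 1) * W) ^ (1 / 2 : ℝ) := by
    intro f hf
    refine (lintegral_prod_mul_le_interpolation hα hβ hκ0 hκ1 hακ hβκ hf hvm hHm hE2 hEtop
      hS).trans ?_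
    gcongr
  have hT : ∫⁻ z, (‖u z‖ₑ ^ 2 + 2 * ‖p z‖ₑ) * (‖ψ z‖ₑ * ‖u z‖ₑ) ∂(μ.prod ν)
      ≤ (N + 2 * N') * ((K + 1) * W) ^ (1 / 2 : ℝ) := by
    have e : ∀ z, (‖u z‖ₑ ^ 2 + 2 * ‖p z‖ₑ) * (‖ψ z‖ₑ * ‖u z‖ₑ)
      = ‖u z‖ₑ ^ 2 * (‖ψ z‖ₑ * ‖u z‖ₑ) + 2 * (‖p z‖ₑ * (‖ψ z‖ₑ * ‖u z‖ₑ)) := fun z => by ring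
    simp only [e]
    have hm3 : AEMeasurable (fun z => ‖u z‖ₑ ^ 2 * (‖ψ z‖ₑ * ‖u z‖ₑ)) (μ.prod ν) :=
      (hum.pow_const 2).mul hvm
    rw [lintegral_add_left' hm3, lintegral_const_mul' _ _ (by simp),
      add_mul, mul_assoc]
    gcongr
    · exact hI _ (hum.pow_const 2)
    · exact hI _ hpm
  set l₁ := ENNReal.ofReal (6 * L / r) with hl₁
  set l₂ := ENNReal.ofReal (L / r ^ 2) with hl₂
  have hWle : W ≤ (2 * l₂ + l ^ 2) * U
      + (2 * (l₁ * (N + 2 * N')) * ((K : ℝ≥0∞) + 1) ^ (1 / 2 : ℝ)) * W ^ (1 / 2 : ℝ) := by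
    calc W ≤ 2 * (l₂ * U + l₁ * ((N + 2 * N') * ((K + 1) * W) ^ (1 / 2 : ℝ))) + l ^ 2 * U := by
          rw [hW]
          gcongr
          exact hflux.trans (by gcongr)
      _ = _ := by
          rw [ENNReal.mul_rpow_of_nonneg _ _ (by norm_num)]
          ring
  have hfin := le_of_le_add_mul_sqrt hWtop hWle
  calc E + 2 * F ≤ W := le_self_add
    _ ≤ _ := hfin
    _ = _ := by
      have e : (((K : ℝ≥0∞) + 1) ^ (1 / 2 : ℝ)) ^ 2 = K + 1 := by
        rw [← ENNReal.rpow_natCast, ← ENNReal.rpow_mul]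
        norm_num
      rw [mul_pow _ (_ ^ (1 / 2 : ℝ)), e]
      push_cast
      ring

end EnergyBound

/-! ### Translation into the scale-invariant quantities -/

section ScaledQuantities

variable {u : SpaceTime → Space} {Du : SpaceTime → Fin 3 → Fin 3 → ℝ} {p : SpaceTime → ℝ}
  {z₀ : SpaceTime} {r L : ℝ} {ψ : SpaceTime → ℝ}

theorem IsParabolicCutoff.enorm_eq_one (hψ : IsParabolicCutoff L z₀ r ψ) {x : Space} {t : ℝ}
    (hx : x ∈ Metric.ball z₀.1 (r / 2)) (ht : t ∈ Ioo (z₀.2 - (r / 2) ^ 2) z₀.2) :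
    ‖ψ (x, t)‖ₑ = 1 := by
  rw [hψ.eq_one (x, t) (mem_ball_iff_norm.1 hx).le
    (by rw [abs_le]; constructor <;> linarith [ht.1, ht.2, sq_nonneg (r / 2)])]
  simp

theorem scaledA_add_scaledB_le_cutoffEnergy (hψ : IsParabolicCutoff L z₀ r ψ) (hr : 0 < r) :
    scaledA u z₀ (r / 2) + scaledB Du z₀ (r / 2)
      ≤ 2 * ENNReal.ofReal r⁻¹ * cutoffEnergy u Du ψ z₀ r := by
  have h2 : ENNReal.ofReal (r / 2)⁻¹ = 2 * ENNReal.ofReal r⁻¹ := by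
    rw [inv_div, div_eq_mul_inv, ENNReal.ofReal_mul (by norm_num), ENNReal.ofReal_ofNat]
  have hball : Metric.ball z₀.1 (r / 2) ⊆ Metric.ball z₀.1 r :=
    Metric.ball_subset_ball (by linarith)
  have hIoo : Ioo (z₀.2 - (r / 2) ^ 2) z₀.2 ⊆ Ioo (z₀.2 - r ^ 2) z₀.2 :=
    Ioo_subset_Ioo_left (by nlinarith)
  rw [cutoffEnergy, mul_add]
  refine add_le_add ?_ ?_
  -- The essential supremum ignores the two endpoints, so the open interval of the energy estimate
  -- suffices.
  · rw [scaledA, ← restrict_Ioo_eq_restrict_Icc, h2]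
    refine essSup_le_of_ae_le _ ?_
    filter_upwards [ae_restrict_of_ae_restrict_of_subset hIoo
      (ae_le_essSup (μ := volume.restrict (Ioo (z₀.2 - r ^ 2) z₀.2)) (f := fun t =>
        ∫⁻ x in Metric.ball z₀.1 r, (‖ψ (x, t)‖ₑ * ‖u (x, t)‖ₑ) ^ 2)),
      ae_restrict_mem measurableSet_Ioo] with t ht1 ht2
    gcongr
    refine le_trans ?_ ht1
    calc ∫⁻ x in Metric.ball z₀.1 (r / 2), ‖u (x, t)‖ₑ ^ 2
        = ∫⁻ x in Metric.ball z₀.1 (r / 2), (‖ψ (x, t)‖ₑ * ‖u (x, t)‖ₑ) ^ 2 := by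
          refine setLIntegral_congr_fun measurableSet_ball fun x hx => ?_
          simp only [hψ.enorm_eq_one hx ht2, one_mul]
      _ ≤ _ := lintegral_mono_set hball
  · rw [scaledB, h2]
    gcongr
    calc ∫⁻ z in Metric.ball z₀.1 (r / 2) ×ˢ Ioo (z₀.2 - (r / 2) ^ 2) z₀.2,
          ENNReal.ofReal (frobSq (Du z))
        = ∫⁻ z in Metric.ball z₀.1 (r / 2) ×ˢ Ioo (z₀.2 - (r / 2) ^ 2) z₀.2,
          ‖ψ z‖ₑ ^ 2 * ENNReal.ofReal (frobSq (Du z)) := by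
          refine setLIntegral_congr_fun (measurableSet_ball.prod measurableSet_Ioo) fun z hz => ?_
          simp only [hψ.enorm_eq_one hz.1 hz.2, one_pow, one_mul]
      _ ≤ ∫⁻ z in Metric.ball z₀.1 r ×ˢ Ioo (z₀.2 - r ^ 2) z₀.2,
          ‖ψ z‖ₑ ^ 2 * ENNReal.ofReal (frobSq (Du z)) :=
          lintegral_mono_set (prod_mono hball hIoo)
      _ ≤ _ := le_mul_of_one_le_left' (by norm_num)

theorem ofReal_rpow_rpow_one_div {β : ℝ} (hβ : 0 < β) (hr : 0 < r) :
    ENNReal.ofReal (r ^ (-(3 * β / 2))) ^ (1 / β) = ENNReal.ofReal (r ^ (-(3 / 2) : ℝ)) := by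
  rw [ENNReal.ofReal_rpow_of_nonneg (by positivity) (by positivity), ← Real.rpow_mul hr.le]
  congr 2
  field_simp

/-- The `L^{2α}` norm of `u`, squared, is the `L^α` norm of `|u|²`; after the power `1/β` the
prefactor is `r^{-3/2}` for every `β`. -/
theorem scaledC_rpow_eq {α β : ℝ} (hα : 0 < α) (hβ : 0 < β) (hr : 0 < r)
    (u : SpaceTime → Space) (z₀ : SpaceTime) :
    scaledC α β u z₀ r ^ (1 / β) = ENNReal.ofReal (r ^ (-(3 / 2) : ℝ))
      * mixedNorm α β (volume.restrict (Metric.ball z₀.1 r))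
        (volume.restrict (Ioo (z₀.2 - r ^ 2) z₀.2)) (fun z => ‖u z‖ₑ ^ 2) := by
  rw [scaledC, ENNReal.mul_rpow_of_nonneg _ _ (by positivity), ofReal_rpow_rpow_one_div hβ hr,
    mixedNorm]
  congr 3
  ext t
  rw [eLpNorm_eq_lintegral_rpow_enorm_toReal (by simpa using hα) ENNReal.ofReal_ne_top,
    ENNReal.toReal_ofReal (by positivity), ← ENNReal.rpow_mul]
  congr 1
  · refine lintegral_congr fun x => ?_
    rw [← ENNReal.rpow_natCast, ← ENNReal.rpow_mul]
    norm_num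
  · field_simp

theorem scaledD_rpow_eq {α β : ℝ} (hα : 0 < α) (hβ : 0 < β) (hr : 0 < r)
    (p : SpaceTime → ℝ) (z₀ : SpaceTime) :
    scaledD α β p z₀ r ^ (1 / β) = ENNReal.ofReal (r ^ (-(3 / 2) : ℝ))
      * mixedNorm α β (volume.restrict (Metric.ball z₀.1 r))
        (volume.restrict (Ioo (z₀.2 - r ^ 2) z₀.2)) (fun z => ‖p z‖ₑ) := by
  rw [scaledD, ENNReal.mul_rpow_of_nonneg _ _ (by positivity), ofReal_rpow_rpow_one_div hβ hr,
    mixedNorm]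
  congr 3
  ext t
  rw [eLpNorm_eq_lintegral_rpow_enorm_toReal (by simpa using hα) ENNReal.ofReal_ne_top,
    ENNReal.toReal_ofReal (by positivity), ← ENNReal.rpow_mul]
  congr 1
  field_simp

/-- The power of `r` is `3(1 - 1/α) + 2(1 - 1/β) = 5 - 7/2`. Replacing the unit ball's volume by
itself plus one makes its power `1 - 1/α ≤ 1` bounded uniformly in `α`. -/
theorem lintegral_parabolicCylinder_le {α β : ℝ} (hα : 1 ≤ α) (hβ : 1 ≤ β)
    (hαβ : 3 / α + 2 / β = 7 / 2) (hr : 0 < r) (z₀ : SpaceTime) {f : SpaceTime → ℝ≥0∞}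
    (hf : AEMeasurable f
      (volume.restrict (Metric.ball z₀.1 r ×ˢ Ioo (z₀.2 - r ^ 2) z₀.2))) :
    ∫⁻ z in Metric.ball z₀.1 r ×ˢ Ioo (z₀.2 - r ^ 2) z₀.2, f z
      ≤ mixedNorm α β (volume.restrict (Metric.ball z₀.1 r))
        (volume.restrict (Ioo (z₀.2 - r ^ 2) z₀.2)) f
        * ((volume (Metric.ball (0 : Space) 1) + 1) * ENNReal.ofReal (r ^ (3 / 2 : ℝ))) := by
  have hα1 : 1 / α ≤ 1 := by rw [div_le_one (by linarith)]; exact hα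
  have hα0 : 0 ≤ 1 / α := by positivity
  have hβ1 : 1 / β ≤ 1 := by rw [div_le_one (by linarith)]; exact hβ
  rw [volume_restrict_prod] at hf ⊢
  have : IsFiniteMeasure (volume.restrict (Metric.ball z₀.1 r)) :=
    isFiniteMeasure_restrict.2 measure_ball_lt_top.ne
  refine (lintegral_prod_le_mixedNorm hα hβ hf).trans (mul_le_mul_right ?_ _)
  set V := volume (Metric.ball (0 : Space) 1) with hV
  rw [Measure.restrict_apply_univ, Measure.restrict_apply_univ, Real.volume_Ioo,
    Measure.addHaar_ball_of_pos _ _ hr, finrank_euclideanSpace, Fintype.card_fin, sub_sub_cancel,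
    ENNReal.mul_rpow_of_nonneg _ _ (by linarith),
    ENNReal.ofReal_rpow_of_nonneg (by positivity) (by linarith),
    ENNReal.ofReal_rpow_of_nonneg (by positivity) (by linarith), mul_right_comm,
    ← ENNReal.ofReal_mul (by positivity), mul_comm]
  have e : (r ^ 3) ^ (1 - 1 / α) * (r ^ 2) ^ (1 - 1 / β) = r ^ (3 / 2 : ℝ) := by
    rw [← Real.rpow_natCast, ← Real.rpow_natCast, ← Real.rpow_mul hr.le, ← Real.rpow_mul hr.le,
      ← Real.rpow_add hr]
    congr 1
    push_cast
    linear_combination -hαβ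
  rw [e]
  gcongr
  calc V ^ (1 - 1 / α) ≤ (V + 1) ^ (1 - 1 / α) :=
        ENNReal.rpow_le_rpow le_self_add (by linarith)
    _ ≤ (V + 1) ^ (1 : ℝ) := ENNReal.rpow_le_rpow_of_exponent_le le_add_self (by linarith)
    _ = _ := ENNReal.rpow_one _

end ScaledQuantities

end NavierStokes

end

/-! ### Choice of exponents and of the absolute constant -/

theorem proposition3p2 :
    ∃ C : ℝ≥0, ∀ (α β : ℝ), α ∈ Set.Icc (6 / 5 : ℝ) 2 → β = 4 * α / (7 * α - 6) →
      ∀ (z₀ : NavierStokes.SpaceTime) (r : ℝ), 0 < r →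
      ∀ (u : NavierStokes.SpaceTime → NavierStokes.Space)
        (Du : NavierStokes.SpaceTime → Fin 3 → Fin 3 → ℝ) (p : NavierStokes.SpaceTime → ℝ),
        NavierStokes.IsSuitableWeakSolution u Du p
          (Metric.ball z₀.1 r) (z₀.2 - r ^ 2) z₀.2 →
        NavierStokes.scaledA u z₀ (r / 2) + NavierStokes.scaledB Du z₀ (r / 2) ≤
          (C : ℝ≥0∞) *
            (NavierStokes.scaledC α β u z₀ r ^ (1 / β)
              + NavierStokes.scaledC α β u z₀ r ^ (2 / β)
              + NavierStokes.scaledD α β p z₀ r ^ (2 / β)) := by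
  open NavierStokes in
  obtain ⟨L, hL, hcut⟩ := exists_isParabolicCutoff
  obtain ⟨K, hK⟩ := exists_cutoffEnergy_le
  obtain ⟨V, hV⟩ : ∃ V : ℝ≥0, (V : ℝ≥0∞) = volume (Metric.ball (0 : Space) 1) :=
    ⟨_, ENNReal.coe_toNNReal measure_ball_lt_top.ne⟩
  -- The first summand carries `2 · 2` from passing to radius `r/2` and from absorption; in the
  -- second, `576 = 2 · 6² · 8`, with 8 from `hyoung`.
  refine ⟨4 * (2 * L.toNNReal + L.toNNReal ^ 2) * (V + 1) + 576 * K * L.toNNReal ^ 2, ?_⟩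
  rintro α β ⟨hα1, hα2⟩ hβ z₀ r hr u Du p h
  obtain ⟨ψ, hψ⟩ := hcut z₀ r hr
  have hα0 : 0 < α := by linarith
  have h7 : 0 < 7 * α - 6 := by linarith
  have hβ1 : 1 ≤ β := by rw [hβ, le_div_iff₀ h7]; linarith
  have hβ0 : 0 < β := by linarith
  have hβi : 1 / β = 7 / 4 - 3 / 2 * (1 / α) := by
    rw [hβ]
    field_simp
    ring
  have hα3 : 1 / α ≤ 5 / 6 := by rw [div_le_div_iff₀ hα0 (by norm_num)]; linarith
  have hα4 : 1 / 2 ≤ 1 / α := by rw [div_le_div_iff₀ (by norm_num) hα0]; linarith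
  -- This `κ` solves `1/α = 1/2 + 2κ/3`; the formula for `β` then amounts to `1/β = 1 - κ`.
  have hE := hK α β (3 / 2 * (1 / α - 1 / 2)) hα0 hβ0 (by linarith) (by linarith) (by ring)
    (by rw [hβi]; ring) z₀ r L hr hL u Du p ψ h hψ
  have hU := lintegral_parabolicCylinder_le (α := α) (by linarith) hβ1
    (by linear_combination 2 * hβi) hr z₀ (h.measurable_u.enorm.pow_const 2)
  have hAB := scaledA_add_scaledB_le_cutoffEnergy (u := u) (Du := Du) hψ hr
  have hsq : ∀ a : ℝ≥0∞, a ^ (2 / β) = (a ^ (1 / β)) ^ 2 := fun a => by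
    rw [← ENNReal.rpow_natCast, ← ENNReal.rpow_mul]
    congr 1
    push_cast
    ring
  rw [hsq, hsq, scaledC_rpow_eq hα0 hβ0 hr, scaledD_rpow_eq hα0 hβ0 hr]
  rw [← hV] at hU
  set N := mixedNorm α β (volume.restrict (Metric.ball z₀.1 r))
        (volume.restrict (Ioo (z₀.2 - r ^ 2) z₀.2)) (fun z => ‖u z‖ₑ ^ 2)
  set N' := mixedNorm α β (volume.restrict (Metric.ball z₀.1 r))
        (volume.restrict (Ioo (z₀.2 - r ^ 2) z₀.2)) (fun z => ‖p z‖ₑ)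
  set ρ := ENNReal.ofReal (r ^ (-(3 / 2) : ℝ)) with hρ
  set i := ENNReal.ofReal r⁻¹ with hi
  -- Scaling: both sides are `r⁻³`, so the quadratic term is in terms of `ρ N` and `ρ N'`; with
  -- `hρ3` the linear one becomes `ρ N`.
  have hi3 : i * i ^ 2 = ρ ^ 2 := by
    rw [hi, hρ, ← ENNReal.ofReal_pow (by positivity), ← ENNReal.ofReal_pow (by positivity),
      ← ENNReal.ofReal_mul (by positivity), ← Real.rpow_mul_natCast hr.le, ← pow_succ',
      ← Real.rpow_neg_one, ← Real.rpow_mul_natCast hr.le]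
    norm_num
  have hρ3 : ρ ^ 2 * ENNReal.ofReal (r ^ (3 / 2 : ℝ)) = ρ := by
    rw [hρ, ← ENNReal.ofReal_pow (by positivity), ← ENNReal.ofReal_mul (by positivity),
      ← Real.rpow_mul_natCast hr.le, ← Real.rpow_add hr]
    norm_num
  have e1 : ENNReal.ofReal (L / r ^ 2) = L.toNNReal * i ^ 2 := by
    rw [hi, div_eq_mul_inv, ENNReal.ofReal_mul hL, ← inv_pow, ENNReal.ofReal_pow (by positivity)]
    rfl
  have e2 : ENNReal.ofReal (L / r) = L.toNNReal * i := by
    rw [hi, div_eq_mul_inv, ENNReal.ofReal_mul hL]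
    rfl
  have e3 : ENNReal.ofReal (6 * L / r) = 6 * (L.toNNReal * i) := by
    rw [mul_div_assoc, ENNReal.ofReal_mul (by norm_num), e2, ENNReal.ofReal_ofNat]
  rw [e1, e2, e3] at hE
  set Λ : ℝ≥0∞ := (L.toNNReal : ℝ≥0∞)
  have hyoung : (ρ * N + 2 * (ρ * N')) ^ 2 ≤ 8 * ((ρ * N) ^ 2 + (ρ * N') ^ 2) := by
    have := ENNReal.rpow_add_le_mul_rpow_add_rpow (ρ * N) (2 * (ρ * N')) (p := 2) (by norm_num)
    norm_num at this
    refine this.trans ?_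
    calc _ = 2 * (ρ * N) ^ 2 + 8 * (ρ * N') ^ 2 := by ring
      _ ≤ 8 * (ρ * N) ^ 2 + 8 * (ρ * N') ^ 2 := by gcongr; norm_num
      _ = _ := by ring
  calc scaledA u z₀ (r / 2) + scaledB Du z₀ (r / 2)
      ≤ 2 * i * (2 * ((2 * (Λ * i ^ 2) + (Λ * i) ^ 2)
          * (N * ((V + 1) * ENNReal.ofReal (r ^ (3 / 2 : ℝ)))))
        + K * (6 * (Λ * i) * (N + 2 * N')) ^ 2) := by
        refine hAB.trans (mul_le_mul_right (hE.trans ?_) _)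
        gcongr
    _ = 4 * (2 * Λ + Λ ^ 2) * (V + 1) * ((i * i ^ 2 * ENNReal.ofReal (r ^ (3 / 2 : ℝ))) * N)
        + 72 * K * Λ ^ 2 * (i * i ^ 2 * (N + 2 * N') ^ 2) := by ring
    _ = 4 * (2 * Λ + Λ ^ 2) * (V + 1) * (ρ * N)
        + 72 * K * Λ ^ 2 * (ρ * N + 2 * (ρ * N')) ^ 2 := by
        rw [hi3, hρ3]
        ring
    _ ≤ 4 * (2 * Λ + Λ ^ 2) * (V + 1) * (ρ * N + (ρ * N) ^ 2 + (ρ * N') ^ 2)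
        + 72 * K * Λ ^ 2 * (8 * (ρ * N + (ρ * N) ^ 2 + (ρ * N') ^ 2)) := by
        gcongr
        · rw [add_assoc]
          exact le_self_add
        · refine hyoung.trans ?_
          rw [add_assoc]
          exact mul_le_mul_right le_add_self _
    _ = _ := by
        push_cast
        ring
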